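/- Let $d\ge 1$ and $b\ge 0$ be integers, $\mathcal S_b=\{p\in\mathbb N^d:|p|=p_1+\dots+p_d\le b\}$, $N_b=\#\mathcal S_b$, and $U(z)=(z^p)_{p\in\mathcal S_b}$ with $z^p=\prod_j z_j^{p_j}$. Let $K:\mathbb R^d\to\mathbb R_+$ be a bounded measurable kernel that vanishes outside $[-\frac12,\frac12]^d$, with $\int K=1$ and $K_\infty=\sup K$; let $\lambda$ be the smallest eigenvalue of $\int_{[-1/2,1/2]^d}U(x)U(x)^\top K(x)\,dx$, and $$\Sigma=2+2\sum_{l\ge1}d^2\,10^{2l-1}\exp\Big\{-\frac{18\cdot10^l}{\pi^4l^4}\,\frac{(8K_\infty)^{-1}}{K_\infty+1/3}\Big\}.$$ Let $\rho:\mathbb R\to\mathbb R_+$ be even, convex and differentiable with $\rho(0)=0$, $\rho'$ 1-Lipschitz and $\dot\rho_\infty=\sup|\rho'|<\infty$ (so $\rho''$ exists almost everywhere), and let $L_\rho,\alpha,c>0$. Then there is $\delta>0$, depending only on these data ($d,b,K,\rho,L_\rho,\alpha,c$), such that the following holds for all $n\ge1$, all symmetric probability densities $g_1,\dots,g_n$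 on $\mathbb R$ that are monotone on the positive half-line and satisfy $\min_i\int\rho''g_i\ge c$ and $$\max_i\int_{\mathbb R}|\rho''(z+u)-\rho''(z+v)|\,g_i(z)\,dz\le L_\rho|u-v|^\alpha\qquad(u,v\in\mathbb R),$$ all $h>n^{-1/d}$, $M>0$, and all $x_0\in[0,1]^d$ such that the kernel window lies in the cube, that is, $x_0+hz\in[0,1]^d$ whenever $K(z)\ne0$. Let $V=\prod_j[x_{0,j}-\frac h2,x_{0,j}+\frac h2]\cap[0,1]^d$, $\Theta(M)=\{t\in\mathbb R^{N_b}:\|t\|_1\le M\}$ and $f_t(x)=\sum_{p\in\mathcal S_b}t_p\big(\frac{x-x_0}h\big)^p\mathbf 1_V(x)$. For measurable $f:[0,1]^d\to\mathbb R$ let $\theta=(\theta_p)_{p\in\mathcal S_b}$ with $\theta_p=\partial^pf(x_0)\,h^{|p|}/(p_1!\cdots p_d!)$, where $\theta_p=0$ if $\partial^pf(x_0)$ does not exist (so $\theta_0=f(x_0)$), and let $b_h=\sup_{x\in V}|f(x)-f_\theta(x)|$. Assume $\|\theta\|_1\le M$ and $b_h<\infty$. Let $X_1,\dots,X_n$ be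 independent and uniform on $[0,1]^d$, let $\xi_1,\dots,\xi_n$ be independent, $\xi_i$ with density $g_i$, and independent of the family $(X_i)$, and let $Y_i=f(X_i)+\xi_i$. Let $\hat\theta(h)$ be any minimizer over $t\in\Theta(M)$ of $$\frac1{nh^d}\sum_{i=1}^n\rho\big(Y_i-f_t(X_i)\big)K\Big(\frac{X_i-x_0}h\Big),$$ and $\hat f^h(x_0)=\hat\theta_{0,\dots,0}(h)$. Then for every $\varepsilon\ge\frac{4N_b}{c\lambda}\big(1\vee b_h\sqrt{nh^d}\big)$, $$\mathbb P\Big(\sqrt{nh^d}\,\big|\hat f^h(x_0)-f(x_0)\big|\ge\varepsilon,\ \|\hat\theta(h)-\theta\|_2\le\delta\Big)\le N_b\,\Sigma\,\exp\left\{-\frac{\Big(\frac{c\lambda}{2N_b}\varepsilon-\big(1\vee b_h\sqrt{nh^d}\big)\Big)^2}{8K_\infty^2(1\vee\dot\rho_\infty^2)+\frac{4K_\infty}{3N_b}(1\vee\dot\rho_\infty)\frac{c\lambda\varepsilon}{\sqrt{nh^d}}}\right\}.$$ -/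

import Mathlib

open MeasureTheory ProbabilityTheory Filter Topology

noncomputable section

namespace LocalM

/-- Multi-indices `p ∈ ℕ^d` with `|p| = p₁ + ⋯ + p_d ≤ b`. -/
def multiIdx (d b : ℕ) : Finset (Fin d → ℕ) :=
  (Fintype.piFinset fun _ => Finset.range (b + 1)).filter fun p => ∑ j, p j ≤ b

theorem mem_multiIdx {d b : ℕ} {p : Fin d → ℕ} : p ∈ multiIdx d b ↔ ∑ j, p j ≤ b := by
  simp only [multiIdx, Finset.mem_filter, Fintype.mem_piFinset, Finset.mem_range,
    and_iff_right_iff_imp]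
  intro hp j
  have := Finset.single_le_sum (f := p) (fun _ _ => Nat.zero_le _) (Finset.mem_univ j)
  omega

/-- The multi-index `(0, …, 0)`. -/
def zeroIdx (d b : ℕ) : multiIdx d b := ⟨0, by simp [mem_multiIdx]⟩

/-- The number `N_b` of multi-indices of length at most `b`. -/
def numIdx (d b : ℕ) : ℕ := (multiIdx d b).card

/-- The monomial `z^p = ∏ j, z_j ^ p_j`. -/
def monomial {d : ℕ} (p : Fin d → ℕ) (z : Fin d → ℝ) : ℝ := ∏ j, z j ^ p j

/-- The unit cube `[0,1]^d`. -/
def unitCube (d : ℕ) : Set (Fin d → ℝ) := Set.Icc 0 1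

/-- The neighbourhood `V_{x₀}(h) = ∏ j [x₀ⱼ - h/2, x₀ⱼ + h/2] ∩ [0,1]^d`. -/
def nbhd {d : ℕ} (x₀ : Fin d → ℝ) (h : ℝ) : Set (Fin d → ℝ) :=
  {x | ∀ j, x j ∈ Set.Icc (x₀ j - h / 2) (x₀ j + h / 2)} ∩ unitCube d

/-- The local polynomial `f_t(x) = ∑_p t_p ((x - x₀)/h)^p · 1_{V_{x₀}(h)}(x)`. -/
def localPoly {d b : ℕ} (x₀ : Fin d → ℝ) (h : ℝ) (t : multiIdx d b → ℝ) :
    (Fin d → ℝ) → ℝ :=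
  (nbhd x₀ h).indicator fun x => ∑ p, t p * monomial p.1 fun j => (x j - x₀ j) / h

/-- `Θ(M)`: the `ℓ¹` ball of radius `M` in `ℝ^{N_b}`. -/
def paramSet (d b : ℕ) (M : ℝ) : Set (multiIdx d b → ℝ) := {t | ∑ p, |t p| ≤ M}

/-- `B(θ, r) = {t ∈ Θ(M) : ‖t - θ‖₂ ≤ r}`. -/
def paramBall {d b : ℕ} (M : ℝ) (θ : multiIdx d b → ℝ) (r : ℝ) : Set (multiIdx d b → ℝ) :=
  {t | t ∈ paramSet d b M ∧ √(∑ p, (t p - θ p) ^ 2) ≤ r}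

/-- Sup-norm of a real-valued function (used for bounded functions only). -/
def supNorm {α : Type*} (φ : α → ℝ) : ℝ := ⨆ a, |φ a|

/-- Kernels: nonnegative bounded measurable functions vanishing outside `[-1/2,1/2]^d`,
with integral one. -/
structure IsKernel {d : ℕ} (K : (Fin d → ℝ) → ℝ) : Prop where
  measurable : Measurable K
  nonneg : ∀ z, 0 ≤ K z
  support_subset : Function.support K ⊆ {z | ∀ j, z j ∈ Set.Icc (-(1 / 2) : ℝ) (1 / 2)}
  bounded : BddAbove (Set.range fun z => |K z|)
  integral_eq_one : ∫ z, K z = 1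

/-- The part of the definition of a contrast function that does not involve the noise. -/
structure IsContrast (ρ : ℝ → ℝ) : Prop where
  nonneg : ∀ z, 0 ≤ ρ z
  symm : ∀ z, ρ (-z) = ρ z
  convex : ConvexOn ℝ Set.univ ρ
  zero : ρ 0 = 0
  differentiable : Differentiable ℝ ρ
  deriv_lipschitz : LipschitzWith 1 (deriv ρ)
  deriv_bounded : BddAbove (Set.range fun z => |deriv ρ z|)
  ae_second_deriv : ∀ᵐ z : ℝ, DifferentiableAt ℝ (deriv ρ) z

/-- The averaged Hölder condition on `ρ''`, with constants `L` and `α`, which a contrast function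
satisfies relative to the noise densities `g i`. -/
def SecondDerivHolder (ρ : ℝ → ℝ) (L α : ℝ) {n : ℕ} (g : Fin n → ℝ → ℝ) : Prop :=
  ∀ i, ∀ u v : ℝ,
    ∫ z, |deriv (deriv ρ) (z + u) - deriv (deriv ρ) (z + v)| * g i z ≤ L * |u - v| ^ α

/-- Symmetric probability densities on `ℝ` that are monotone (necessarily nonincreasing) on the
positive half-line; the value at `0` is left free. -/
structure IsSymmMonotoneDensity (g : ℝ → ℝ) : Prop where
  measurable : Measurable g
  nonneg : ∀ z, 0 ≤ g z
  lintegral_eq_one : ∫⁻ z, ENNReal.ofReal (g z) = 1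
  symm : ∀ z, g (-z) = g z
  antitoneOn : AntitoneOn g (Set.Ioi 0)

/-- `c(ρ, (g_i)) = inf_i ∫ ρ'' g_i`. -/
def noiseConst (ρ : ℝ → ℝ) {n : ℕ} (g : Fin n → ℝ → ℝ) : ℝ :=
  ⨅ i, ∫ z, deriv (deriv ρ) z * g i z

/-- The class `G_ρ^{(c)}` of families of noise densities. -/
def densityClass (ρ : ℝ → ℝ) (c : ℝ) (n : ℕ) : Set (Fin n → ℝ → ℝ) :=
  {g | (∀ i, IsSymmMonotoneDensity (g i)) ∧ c ≤ noiseConst ρ g}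

/-- Random design and noise: the `X i` are independent and uniform on `[0,1]^d`, the `ξ i` are
independent with densities `g i`, and the two families are independent of each other. -/
structure IsDesignNoise {Ω : Type*} [MeasurableSpace Ω] (P : Measure Ω) {d n : ℕ}
    (g : Fin n → ℝ → ℝ) (X : Fin n → Ω → Fin d → ℝ) (ξ : Fin n → Ω → ℝ) : Prop where
  measurable_design : ∀ i, Measurable (X i)
  measurable_noise : ∀ i, Measurable (ξ i)
  law_design : ∀ i, P.map (X i) = volume.restrict (unitCube d)
  law_noise : ∀ i, P.map (ξ i) = volume.withDensity fun z => ENNReal.ofReal (g i z)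
  indep_design : iIndepFun X P
  indep_noise : iIndepFun ξ P
  indep : IndepFun (fun ω i => X i ω) (fun ω i => ξ i ω) P

/-- The local criterion `π̃_h(t) = (n h^d)⁻¹ ∑ i, ρ(Y_i - f_t(X_i)) K((X_i - x₀)/h)`. -/
def criterion {d b n : ℕ} (ρ : ℝ → ℝ) (K : (Fin d → ℝ) → ℝ) (x₀ : Fin d → ℝ) (h : ℝ)
    (x : Fin n → Fin d → ℝ) (y : Fin n → ℝ) (t : multiIdx d b → ℝ) : ℝ :=
  1 / (n * h ^ d) *
    ∑ i, ρ (y i - localPoly x₀ h t (x i)) * K fun j => (x i j - x₀ j) / h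

/-- `s` is a minimizer of the local criterion over `Θ(M)`. -/
def IsLocalMEstimate {d b n : ℕ} (ρ : ℝ → ℝ) (K : (Fin d → ℝ) → ℝ) (M : ℝ) (x₀ : Fin d → ℝ)
    (h : ℝ) (x : Fin n → Fin d → ℝ) (y : Fin n → ℝ) (s : multiIdx d b → ℝ) : Prop :=
  s ∈ paramSet d b M ∧ ∀ t ∈ paramSet d b M, criterion ρ K x₀ h x y s ≤ criterion ρ K x₀ h x y t

/-- First partial derivative in direction `j` of a function on `[0,1]^d` (one-sided on the faces). -/
def partialDeriv {d : ℕ} (j : Fin d) (φ : (Fin d → ℝ) → ℝ) (x : Fin d → ℝ) : ℝ :=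
  derivWithin (fun s => φ (Function.update x j s)) (Set.Icc 0 1) (x j)

/-- Iterated partial derivative `∂_{j₁} ∂_{j₂} ⋯ f` along a list of directions. -/
def iterPartial {d : ℕ} : List (Fin d) → ((Fin d → ℝ) → ℝ) → (Fin d → ℝ) → ℝ
  | [], f => f
  | j :: l, f => partialDeriv j (iterPartial l f)

/-- Existence at `x` of the iterated partial derivative: the inner derivative exists at all nearby
points of the coordinate line in `[0,1]^d` and is differentiable along this line at `x`. -/
def IterPartialExists {d : ℕ} : List (Fin d) → ((Fin d → ℝ) → ℝ) → (Fin d → ℝ) → Prop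
  | [], _, _ => True
  | j :: l, f, x =>
    (∀ᶠ s in 𝓝[Set.Icc 0 1] (x j), IterPartialExists l f (Function.update x j s)) ∧
      DifferentiableWithinAt ℝ (fun s => iterPartial l f (Function.update x j s))
        (Set.Icc 0 1) (x j)

/-- The directions `1, …, 1, 2, …, 2, …, d, …, d` with `j` repeated `p_j` times. -/
def directions {d : ℕ} (p : Fin d → ℕ) : List (Fin d) :=
  (List.finRange d).flatMap fun j => List.replicate (p j) j

open Classical in
/-- Taylor coefficients `θ_p = ∂^p f(x₀) h^{|p|} / p!`, with `θ_p = 0` if `∂^p f(x₀)` does not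
exist. For `p = 0` this is `f(x₀)`. -/
def taylorCoeff {d b : ℕ} (f : (Fin d → ℝ) → ℝ) (x₀ : Fin d → ℝ) (h : ℝ) :
    multiIdx d b → ℝ := fun p =>
  if IterPartialExists (directions p.1) f x₀ then
    iterPartial (directions p.1) f x₀ * h ^ (∑ j, p.1 j) / ∏ j, ((p.1 j).factorial : ℝ)
  else 0

/-- The absolute approximation error `|f(x) - f_θ(x)|` on `V_{x₀}(h)`. -/
def biasValues {d : ℕ} (b : ℕ) (f : (Fin d → ℝ) → ℝ) (x₀ : Fin d → ℝ) (h : ℝ) : Set ℝ :=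
  (fun x => |f x - localPoly x₀ h (taylorCoeff (b := b) f x₀ h) x|) '' nbhd x₀ h

/-- The bias `b_h = sup_{x ∈ V_{x₀}(h)} |f(x) - f_θ(x)|` (used when it is finite). -/
def bias {d : ℕ} (b : ℕ) (f : (Fin d → ℝ) → ℝ) (x₀ : Fin d → ℝ) (h : ℝ) : ℝ :=
  sSup (biasValues b f x₀ h)

/-- The matrix `∫_{[-1/2,1/2]^d} U(x) U(x)ᵀ K(x) dx`, where `U` is the vector of monomials. -/
def momentMatrix {d : ℕ} (b : ℕ) (K : (Fin d → ℝ) → ℝ) :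
    Matrix (multiIdx d b) (multiIdx d b) ℝ := fun p q =>
  ∫ x in {z : Fin d → ℝ | ∀ j, z j ∈ Set.Icc (-(1 / 2) : ℝ) (1 / 2)},
    monomial p.1 x * monomial q.1 x * K x

/-- `λ`: the smallest eigenvalue of the moment matrix. -/
def minEigen {d : ℕ} (b : ℕ) (K : (Fin d → ℝ) → ℝ) : ℝ := sInf (spectrum ℝ (momentMatrix b K))

/-- `Σ = 2 + 2 ∑_{l ≥ 1} d² 10^{2l-1} exp(-(18·10^l)/(π⁴ l⁴) · (8K∞)⁻¹/(K∞ + 1/3))`. -/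
def sigmaConst (d : ℕ) (Kinf : ℝ) : ℝ :=
  2 + 2 * ∑' k : ℕ, (d : ℝ) ^ 2 * 10 ^ (2 * (k + 1) - 1) *
    Real.exp (-((18 * 10 ^ (k + 1)) / (Real.pi ^ 4 * ((k : ℝ) + 1) ^ 4) *
      ((8 * Kinf)⁻¹ / (Kinf + 1 / 3))))

/-- The right-hand side of the deviation inequality: `N = N_b`, `S = Σ`, `lam = λ`,
`Kinf = ‖K‖_∞`, `rinf = ‖ρ'‖_∞`, `m = n h^d`, `bh = b_h`. -/
def deviationBound (N S c lam Kinf rinf m bh ε : ℝ) : ℝ :=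
  N * S * Real.exp (-((c * lam / (2 * N) * ε - max 1 (bh * √m)) ^ 2 /
    (8 * Kinf ^ 2 * max 1 (rinf ^ 2) +
      4 * Kinf / (3 * N) * max 1 rinf * (c * lam * ε / √m))))

end LocalM

end

noncomputable section

namespace LocalM

/-! ### Bernstein's inequality -/

/-! Write `m = n h^d`, `N = N_b`, `β = b_h`, `r = ε / √m`, `y = cλε/(2N) - (1 ∨ β√m)`, and let `E`
be the exponent in the claim. On the event, the estimator is at distance at least `r` and at most
`δ` from `θ`. So only `r ≤ δ` matters, and `r` is then as small as desired.

Convexity localises the problem to the sphere of radius `r`. The criterion decreases along the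
segment from `θ` to its minimizer, so where the segment crosses the sphere, at `θ + ru`, the score
in direction `u` is nonnegative (`sum_scoreTerm_nonneg`). The averaged score of the noise is odd,
1-Lipschitz and of slope at least `c/2` near zero (`mul_sq_le_mul_meanScore`). Hence the expected
score in direction `ru` is at most `h^d (β‖ru‖₁ - cλr²/2)` per observation
(`integral_sum_mul_scoreTerm_le`). Since `‖ru‖₁ ≤ Nr`, some component of the centred score at `θ +
ru` has size at least `m(cλr/(2N) - β) ≥ √m y` (`exists_le_abs_deviation`).

The direction `u` is random, but chaining is avoidable: `δ` may depend on the cardinality of one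
fixed finite net `F` of the unit sphere. The deviation at `θ + ru` splits into the deviation at `θ`
(allotted `y/2`), an increment from `θ` to a net point (`y/4`), and an oscillation from the net
point to `θ + ru` (`y/4`), the last being under control as long as the kernel mass of the sample is
below `2m` (`exists_deviation_net`). Bernstein's inequality (`bernstein_abs_ge`) at the centre
yields the exponent `E`. The increments have range of order `δ`, so for small `δ` their exponent
exceeds `E + |F|`, which pays for the union over `F`. Excess kernel mass also has exponent at least
`E`. In total the probability is at most `(2 + 4N) exp(-E)`, and `Σ ≥ 6` (`six_le_sigmaConst`)
finishes. -/

theorem two_mul_three_pow_le_factorial (k : ℕ) : 2 * 3 ^ k ≤ (k + 2).factorial := by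
  induction k with
  | zero => simp
  | succ k ih =>
    rw [show k + 1 + 2 = (k + 2) + 1 by ring, Nat.factorial_succ, pow_succ]
    nlinarith [Nat.zero_le k, Nat.factorial_pos (k + 2)]

/-- From the quadratic term on, the exponential series is dominated by a geometric series of ratio
`s/3`; this is the origin of the `1/3` in Bernstein's inequality. -/
theorem exp_le_one_add_add_sq {x s : ℝ} (hx : |x| ≤ s) (hs : s < 3) :
    Real.exp x ≤ 1 + x + x ^ 2 / (2 * (1 - s / 3)) := by
  have hs0 : 0 ≤ s := (abs_nonneg x).trans hx
  have hexp : HasSum (fun k : ℕ => x ^ k / (k.factorial : ℝ)) (Real.exp x) := by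
    rw [Real.exp_eq_exp_ℝ]
    exact NormedSpace.exp_series_hasSum_exp' x |>.congr_fun (fun k => by rw [smul_eq_mul, div_eq_inv_mul])
  have htail := (hasSum_nat_add_iff' 2).2 hexp
  have hgeo : HasSum (fun k : ℕ => x ^ 2 / 2 * (s / 3) ^ k) (x ^ 2 / 2 * (1 - s / 3)⁻¹) :=
    (hasSum_geometric_of_lt_one (by positivity) (by linarith)).mul_left _
  have hle : ∀ k : ℕ, x ^ (k + 2) / ((k + 2).factorial : ℝ) ≤ x ^ 2 / 2 * (s / 3) ^ k := by
    intro k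
    have hfac : (2 * 3 ^ k : ℝ) ≤ ((k + 2).factorial : ℝ) := by
      exact_mod_cast two_mul_three_pow_le_factorial k
    calc x ^ (k + 2) / ((k + 2).factorial : ℝ)
        ≤ x ^ 2 * s ^ k / ((k + 2).factorial : ℝ) := by
          gcongr
          rw [pow_add, mul_comm]
          refine mul_le_mul_of_nonneg_left ?_ (sq_nonneg x)
          exact (le_abs_self _).trans (by rw [abs_pow]; gcongr)
      _ ≤ x ^ 2 * s ^ k / (2 * 3 ^ k) := by gcongr
      _ = x ^ 2 / 2 * (s / 3) ^ k := by rw [div_pow]; field_simp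
  have h := hasSum_le hle htail hgeo
  simp only [Finset.sum_range_succ, Finset.sum_range_zero, pow_zero, pow_one, Nat.factorial,
    Nat.cast_one, div_one, zero_add, mul_one] at h
  have : x ^ 2 / (2 * (1 - s / 3)) = x ^ 2 / 2 * (1 - s / 3)⁻¹ := by
    rw [div_mul_eq_div_div, div_eq_mul_inv (x ^ 2 / 2)]
  rw [this]
  linarith

theorem mgf_le_exp_of_abs_le {Ω : Type*} [MeasurableSpace Ω] {P : Measure Ω}
    [IsProbabilityMeasure P] {Y : Ω → ℝ} (hY : Measurable Y) {B : ℝ} (hB : ∀ ω, |Y ω| ≤ B)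
    (h0 : ∫ ω, Y ω ∂P = 0) {u : ℝ} (hu : 0 ≤ u) (huB : u * B < 3) :
    mgf Y P u ≤ Real.exp (u ^ 2 / (2 * (1 - u * B / 3)) * ∫ ω, Y ω ^ 2 ∂P) := by
  have hYi : Integrable Y P := Integrable.of_bound hY.aestronglyMeasurable B (ae_of_all _ hB)
  have hY2 : Integrable (fun ω => Y ω ^ 2) P := by
    refine Integrable.of_bound (hY.pow_const 2).aestronglyMeasurable (B ^ 2) (ae_of_all _ fun ω => ?_)
    rw [Real.norm_eq_abs, abs_pow]
    exact pow_le_pow_left₀ (abs_nonneg _) (hB ω) 2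
  have hbd : ∀ ω, Real.exp (u * Y ω) ≤
      1 + u * Y ω + u ^ 2 / (2 * (1 - u * B / 3)) * Y ω ^ 2 := by
    intro ω
    have := exp_le_one_add_add_sq (x := u * Y ω) (s := u * B)
      (by rw [abs_mul, abs_of_nonneg hu]; exact mul_le_mul_of_nonneg_left (hB ω) hu) huB
    refine this.trans (le_of_eq ?_)
    ring
  calc mgf Y P u ≤ ∫ ω, (1 + u * Y ω + u ^ 2 / (2 * (1 - u * B / 3)) * Y ω ^ 2) ∂P :=
        integral_mono_of_nonneg (ae_of_all _ fun ω => (Real.exp_pos _).le)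
          (((integrable_const 1).add (hYi.const_mul u)).add (hY2.const_mul _)) (ae_of_all _ hbd)
    _ = 1 + u ^ 2 / (2 * (1 - u * B / 3)) * ∫ ω, Y ω ^ 2 ∂P := by
        have h1 : Integrable (fun ω => 1 + u * Y ω) P :=
          (integrable_const 1).add (hYi.const_mul u)
        rw [integral_add h1 (hY2.const_mul _),
          integral_add (integrable_const 1) (hYi.const_mul u), integral_const_mul,
          integral_const_mul, h0]
        simp
    _ ≤ _ := by
        rw [add_comm]
        exact Real.add_one_le_exp _

/-- Bernstein's inequality for bounded centred independent variables. -/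
theorem bernstein_sum_ge {Ω ι : Type*} [MeasurableSpace Ω] {P : Measure Ω}
    [IsProbabilityMeasure P] [Fintype ι] {Y : ι → Ω → ℝ} (hind : iIndepFun Y P)
    (hY : ∀ i, Measurable (Y i)) {B V t : ℝ} (hB : ∀ i ω, |Y i ω| ≤ B) (hB0 : 0 ≤ B)
    (h0 : ∀ i, ∫ ω, Y i ω ∂P = 0) (hV0 : 0 < V) (hV : ∑ i, ∫ ω, Y i ω ^ 2 ∂P ≤ V)
    (ht : 0 ≤ t) :
    P.real {ω | t ≤ ∑ i, Y i ω} ≤ Real.exp (-(t ^ 2 / (2 * (V + B * t / 3)))) := by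
  set W := V + B * t / 3 with hW
  have hWpos : 0 < W := by positivity
  -- This Chernoff parameter turns `1 - uB/3` into `V/W`, so that the exponent collapses to
  -- `-t²/(2W)`.
  set u := t / W with hu
  have hu0 : 0 ≤ u := by positivity
  have huB : u * B < 3 := by
    rw [hu, div_mul_eq_mul_div, div_lt_iff₀ hWpos, hW]
    linarith
  have hfac : 1 - u * B / 3 = V / W := by
    rw [hu]; field_simp; rw [hW]; ring
  have hint : ∀ i, Integrable (fun ω => Real.exp (u * Y i ω)) P := fun i =>
    integrable_exp_mul_of_le u B hu0 (hY i).aemeasurable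
      (ae_of_all _ fun ω => (le_abs_self _).trans (hB i ω))
  have hsum : (fun ω => ∑ i, Y i ω) = ∑ i, Y i := by ext ω; simp
  have hints : Integrable (fun ω => Real.exp (u * ∑ i, Y i ω)) P := by
    have := hind.integrable_exp_mul_sum hY (s := Finset.univ) (t := u) (fun i _ => hint i)
    simpa using this
  calc P.real {ω | t ≤ ∑ i, Y i ω}
      ≤ Real.exp (-u * t) * mgf (fun ω => ∑ i, Y i ω) P u :=
        measure_ge_le_exp_mul_mgf t hu0 hints
    _ = Real.exp (-u * t) * ∏ i, mgf (Y i) P u := by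
        rw [hsum, hind.mgf_sum hY Finset.univ]
    _ ≤ Real.exp (-u * t) *
          ∏ i, Real.exp (u ^ 2 / (2 * (1 - u * B / 3)) * ∫ ω, Y i ω ^ 2 ∂P) := by
        gcongr with i
        · exact fun i _ => mgf_nonneg
        · exact mgf_le_exp_of_abs_le (hY i) (hB i) (h0 i) hu0 huB
    _ = Real.exp (-u * t + u ^ 2 / (2 * (V / W)) * ∑ i, ∫ ω, Y i ω ^ 2 ∂P) := by
        rw [← Real.exp_sum, ← Finset.mul_sum, ← Real.exp_add, hfac]
    _ ≤ Real.exp (-u * t + u ^ 2 / (2 * (V / W)) * V) := by gcongr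
    _ = Real.exp (-(t ^ 2 / (2 * W))) := by
        congr 1
        rw [hu]
        field_simp
        ring

/-- Two-sided Bernstein inequality for the deviations of bounded independent variables. -/
theorem bernstein_abs_ge {Ω ι : Type*} [MeasurableSpace Ω] {P : Measure Ω}
    [IsProbabilityMeasure P] [Fintype ι] {Y : ι → Ω → ℝ} (hind : iIndepFun Y P)
    (hY : ∀ i, Measurable (Y i)) {B V t : ℝ} (hB : ∀ i ω, |Y i ω| ≤ B) (hB0 : 0 ≤ B)
    (hV0 : 0 < V) (hV : ∑ i, ∫ ω, Y i ω ^ 2 ∂P ≤ V) (ht : 0 ≤ t) :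
    P.real {ω | t ≤ |∑ i, Y i ω - ∑ i, ∫ ω', Y i ω' ∂P|} ≤
      2 * Real.exp (-(t ^ 2 / (2 * (V + 2 * B * t / 3)))) := by
  have hYi : ∀ i, Integrable (Y i) P := fun i =>
    Integrable.of_bound (hY i).aestronglyMeasurable B (ae_of_all _ (hB i))
  have hY2 : ∀ i, Integrable (fun ω => Y i ω ^ 2) P := fun i => by
    refine Integrable.of_bound ((hY i).pow_const 2).aestronglyMeasurable (B ^ 2)
      (ae_of_all _ fun ω => ?_)
    rw [Real.norm_eq_abs, abs_pow]
    exact pow_le_pow_left₀ (abs_nonneg _) (hB i ω) 2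
  have hmean : ∀ i, |∫ ω, Y i ω ∂P| ≤ B := fun i => by
    simpa using norm_integral_le_of_norm_le_const (μ := P) (f := Y i) (ae_of_all _ (hB i))
  -- The signs `s = ±1` give the two tails. Centring doubles the range to `2B` but does not increase
  -- second moments.
  have key : ∀ s : ℝ, s ^ 2 = 1 → |s| = 1 →
      P.real {ω | t ≤ ∑ i, s * (Y i ω - ∫ ω', Y i ω' ∂P)} ≤
        Real.exp (-(t ^ 2 / (2 * (V + 2 * B * t / 3)))) := by
    intro s hs hs'
    refine bernstein_sum_ge (Y := fun i ω => s * (Y i ω - ∫ ω', Y i ω' ∂P)) (B := 2 * B)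
      (hind.comp (fun i y => s * (y - ∫ ω', Y i ω' ∂P)) fun i => by fun_prop)
      (fun i => by have := hY i; fun_prop) (fun i ω => ?_) (by positivity) (fun i => ?_) hV0 ?_ ht
    · rw [abs_mul, hs', one_mul]
      exact (abs_sub _ _).trans (by linarith [hB i ω, hmean i])
    · rw [integral_const_mul, integral_sub (hYi i) (integrable_const _)]
      simp
    · refine (Finset.sum_le_sum fun i _ => ?_).trans hV
      have hexp : ∀ ω, (s * (Y i ω - ∫ ω', Y i ω' ∂P)) ^ 2 =
          Y i ω ^ 2 - 2 * (∫ ω', Y i ω' ∂P) * Y i ω + (∫ ω', Y i ω' ∂P) ^ 2 := by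
        intro ω; rw [mul_pow, hs]; ring
      simp_rw [hexp]
      have h1 : Integrable (fun ω => Y i ω ^ 2 - 2 * (∫ ω', Y i ω' ∂P) * Y i ω) P :=
        (hY2 i).sub ((hYi i).const_mul _)
      rw [integral_add h1 (integrable_const _),
        integral_sub (hY2 i) ((hYi i).const_mul _), integral_const_mul]
      simp
      nlinarith [sq_nonneg (∫ ω', Y i ω' ∂P)]
  have hsub : {ω | t ≤ |∑ i, Y i ω - ∑ i, ∫ ω', Y i ω' ∂P|} ⊆
      {ω | t ≤ ∑ i, 1 * (Y i ω - ∫ ω', Y i ω' ∂P)} ∪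
        {ω | t ≤ ∑ i, (-1) * (Y i ω - ∫ ω', Y i ω' ∂P)} := by
    intro ω hω
    simp only [Set.mem_ofPred_eq, Set.mem_union, ← Finset.mul_sum, Finset.sum_sub_distrib] at hω ⊢
    rcases le_abs.1 hω with h | h
    · left; linarith
    · right; linarith
  calc _ ≤ _ := measureReal_mono hsub
    _ ≤ _ := measureReal_union_le _ _
    _ ≤ _ := by
      rw [two_mul]
      exact add_le_add (key 1 (by norm_num) (by norm_num)) (key (-1) (by norm_num) (by norm_num))

/-! ### Independence of pairs -/

/-- If `X` and `ξ` are independent families of independent variables, then the pairs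
`(X i, ξ i)` are independent. -/
theorem iIndepFun_prodMk {Ω ι E F : Type*} [MeasurableSpace Ω] {P : Measure Ω}
    [IsProbabilityMeasure P] [Fintype ι] [MeasurableSpace E] [MeasurableSpace F]
    {X : ι → Ω → E} {ξ : ι → Ω → F}
    (mX : ∀ i, Measurable (X i)) (mξ : ∀ i, Measurable (ξ i))
    (hX : iIndepFun X P) (hξ : iIndepFun ξ P)
    (h : IndepFun (fun ω i => X i ω) (fun ω i => ξ i ω) P) :
    iIndepFun (fun i ω => (X i ω, ξ i ω)) P := by
  classical
  rw [iIndepFun_iff_iIndep]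
  -- Preimages of measurable rectangles form a π-system generating the σ-algebra of each pair, and
  -- on them the three independence hypotheses factor the probability.
  let π : ι → Set (Set Ω) := fun i =>
    {s | ∃ A B, MeasurableSet A ∧ MeasurableSet B ∧ s = X i ⁻¹' A ∩ ξ i ⁻¹' B}
  refine iIndepSets.iIndep (m := fun i => MeasurableSpace.comap (fun ω => (X i ω, ξ i ω)) inferInstance)
    (π := π) (fun i => ?_) (fun i => ?_) (fun i => ?_) ?_
  · exact ((mX i).prodMk (mξ i)).comap_le
  · rintro _ ⟨A, B, hA, hB, rfl⟩ _ ⟨A', B', hA', hB', rfl⟩ -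
    exact ⟨A ∩ A', B ∩ B', hA.inter hA', hB.inter hB', by ext; simp; tauto⟩
  · rw [← generateFrom_prod, MeasurableSpace.comap_generateFrom]
    congr 1
    ext s
    simp only [Set.mem_image, Set.mem_image2, Set.mem_ofPred_eq, π]
    constructor
    · rintro ⟨_, ⟨A, hA, B, hB, rfl⟩, rfl⟩
      exact ⟨A, B, hA, hB, by ext; simp⟩
    · rintro ⟨A, B, hA, hB, rfl⟩
      exact ⟨_, ⟨A, hA, B, hB, rfl⟩, by ext; simp⟩
  · rw [iIndepSets_iff]
    intro S s hs
    choose! A B hA hB hAB using hs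
    have hI : (⋂ i ∈ S, s i) = (⋂ i ∈ S, X i ⁻¹' A i) ∩ (⋂ i ∈ S, ξ i ⁻¹' B i) := by
      rw [Set.iInter₂_congr hAB]
      simp only [Set.iInter_inter_distrib]
    have hXset : (⋂ i ∈ S, X i ⁻¹' A i) =
        (fun ω i => X i ω) ⁻¹' (Set.pi (S : Set ι) A) := by ext; simp [Set.mem_pi]
    have hξset : (⋂ i ∈ S, ξ i ⁻¹' B i) =
        (fun ω i => ξ i ω) ⁻¹' (Set.pi (S : Set ι) B) := by ext; simp [Set.mem_pi]
    have hpair : ∀ i ∈ S, P (s i) = P (X i ⁻¹' A i) * P (ξ i ⁻¹' B i) := by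
      intro i hi
      rw [hAB i hi]
      exact (h.comp (measurable_pi_apply i) (measurable_pi_apply i)).measure_inter_preimage_eq_mul
        _ _ (hA i hi) (hB i hi)
    rw [hI, hXset, hξset, h.measure_inter_preimage_eq_mul _ _
      (MeasurableSet.pi S.countable_toSet fun i hi => hA i hi)
      (MeasurableSet.pi S.countable_toSet fun i hi => hB i hi), ← hXset, ← hξset,
      hX.measure_inter_preimage_eq_mul S (fun i hi => hA i hi),
      hξ.measure_inter_preimage_eq_mul S (fun i hi => hB i hi), ← Finset.prod_mul_distrib]
    exact (Finset.prod_congr rfl fun i hi => (hpair i hi)).symm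

/-! ### Zero sets of polynomials -/

/-- Induction on the number of variables: the leading coefficient with respect to the first variable
is nonzero almost everywhere, and over each such point only finitely many values of the first
variable are roots. Fubini concludes, after a swap that makes the first variable the inner one. -/
theorem ae_eval_ne_zero : ∀ {d : ℕ} {q : MvPolynomial (Fin d) ℝ}, q ≠ 0 →
    ∀ᵐ x : Fin d → ℝ, MvPolynomial.eval x q ≠ 0
  | 0, q, hq => by
    refine ae_of_all _ fun x => ?_
    intro h
    apply hq
    rw [MvPolynomial.eq_C_of_isEmpty q] at h ⊢
    simpa using h
  | d + 1, q, hq => by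
    have hms : MeasurableSet {y : ℝ × (Fin d → ℝ) | MvPolynomial.eval (Fin.cons y.1 y.2) q ≠ 0} := by
      have hc : Continuous fun y : ℝ × (Fin d → ℝ) =>
          MvPolynomial.eval (Fin.cons y.1 y.2 : Fin (d + 1) → ℝ) q := by
        refine (MvPolynomial.continuous_eval q).comp (continuous_pi fun j => ?_)
        refine Fin.cases ?_ (fun j => ?_) j
        · simpa using continuous_fst
        · simp only [Fin.cons_succ]; fun_prop
      exact (isOpen_ne_fun hc continuous_const).measurableSet
    have hprod : ∀ᵐ y : ℝ × (Fin d → ℝ), MvPolynomial.eval (Fin.cons y.1 y.2) q ≠ 0 := by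
      have hlead : (MvPolynomial.finSuccEquiv ℝ d q).leadingCoeff ≠ 0 := by
        simpa using hq
      have hswap : ∀ᵐ y : (Fin d → ℝ) × ℝ ∂(volume.prod volume),
          MvPolynomial.eval (Fin.cons y.2 y.1) q ≠ 0 := by
        refine (Measure.ae_prod_iff_ae_ae (hms.preimage measurable_swap)).2 ?_
        filter_upwards [ae_eval_ne_zero hlead] with x hx
        have hmap : Polynomial.map (MvPolynomial.eval x) (MvPolynomial.finSuccEquiv ℝ d q) ≠ 0 := by
          intro h0
          apply hx
          rw [Polynomial.leadingCoeff, ← Polynomial.coeff_map, h0, Polynomial.coeff_zero]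
        have hfin := (Polynomial.map (MvPolynomial.eval x)
          (MvPolynomial.finSuccEquiv ℝ d q)).rootSet_finite ℝ
        refine measure_mono_null (fun y hy => ?_) (hfin.measure_zero volume)
        simp only [Set.mem_compl_iff, Set.mem_ofPred_eq, not_not] at hy
        rw [MvPolynomial.eval_eq_eval_mv_eval'] at hy
        rw [Polynomial.mem_rootSet]
        exact ⟨hmap, by simpa using hy⟩
      exact (Measure.measurePreserving_swap (μ := (volume : Measure ℝ))
        (ν := (volume : Measure (Fin d → ℝ)))).quasiMeasurePreserving.ae hswap
    have := (volume_preserving_piFinSuccAbove (fun _ : Fin (d + 1) => ℝ)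
      0).quasiMeasurePreserving.ae hprod
    filter_upwards [this] with x hx
    convert hx using 3
    simp [MeasurableEquiv.piFinSuccAbove, Fin.insertNthEquiv]

/-- The polynomial `∑ p, t p * z ^ p` with coefficients `t`. -/
def polyVal {d b : ℕ} (t : multiIdx d b → ℝ) (z : Fin d → ℝ) : ℝ := ∑ p, t p * monomial p.1 z

theorem ae_polyVal_ne_zero {d b : ℕ} {t : multiIdx d b → ℝ} (ht : t ≠ 0) :
    ∀ᵐ z, polyVal t z ≠ 0 := by
  let q : MvPolynomial (Fin d) ℝ :=
    ∑ p : multiIdx d b, MvPolynomial.monomial (Finsupp.equivFunOnFinite.symm p.1) (t p)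
  have hq : q ≠ 0 := by
    obtain ⟨p, hp⟩ := Function.ne_iff.1 ht
    intro h
    apply hp
    have hc := congrArg (MvPolynomial.coeff (Finsupp.equivFunOnFinite.symm p.1)) h
    rw [MvPolynomial.coeff_sum, Finset.sum_eq_single p] at hc
    · simpa using hc
    · intro p' _ hne
      rw [MvPolynomial.coeff_monomial, if_neg]
      intro h'
      exact hne (Subtype.ext (Finsupp.equivFunOnFinite.symm.injective h'))
    · simp
  filter_upwards [ae_eval_ne_zero hq] with z hz
  convert hz using 1
  simp only [polyVal, q, map_sum, MvPolynomial.eval_monomial, monomial]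
  refine Finset.sum_congr rfl fun p _ => ?_
  rw [Finsupp.prod_fintype _ _ (by simp)]
  simp

/-! ### The moment matrix -/

theorem measurable_monomial {d : ℕ} (p : Fin d → ℕ) : Measurable (monomial p) := by
  unfold monomial
  fun_prop

theorem abs_monomial_le_one {d : ℕ} (p : Fin d → ℕ) {z : Fin d → ℝ}
    (hz : ∀ j, z j ∈ Set.Icc (-(1 / 2) : ℝ) (1 / 2)) : |monomial p z| ≤ 1 := by
  rw [monomial, Finset.abs_prod]
  refine Finset.prod_le_one (fun _ _ => abs_nonneg _) fun j _ => ?_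
  rw [abs_pow]
  refine pow_le_one₀ (abs_nonneg _) (abs_le.2 ⟨?_, ?_⟩) <;> linarith [(hz j).1, (hz j).2]

theorem measurable_polyVal {d b : ℕ} (t : multiIdx d b → ℝ) : Measurable (polyVal t) := by
  unfold polyVal
  exact Finset.measurable_sum _ fun p _ => (measurable_monomial p.1).const_mul _

theorem abs_polyVal_le {d b : ℕ} (t : multiIdx d b → ℝ) {z : Fin d → ℝ}
    (hz : ∀ j, z j ∈ Set.Icc (-(1 / 2) : ℝ) (1 / 2)) : |polyVal t z| ≤ ∑ p, |t p| := by
  refine (Finset.abs_sum_le_sum_abs _ _).trans (Finset.sum_le_sum fun p _ => ?_)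
  rw [abs_mul]
  exact mul_le_of_le_one_right (abs_nonneg _) (abs_monomial_le_one _ hz)

theorem IsKernel.mem_of_ne_zero {d : ℕ} {K : (Fin d → ℝ) → ℝ} (hK : IsKernel K)
    {z : Fin d → ℝ} (hz : K z ≠ 0) : ∀ j, z j ∈ Set.Icc (-(1 / 2) : ℝ) (1 / 2) :=
  hK.support_subset hz

theorem IsKernel.le_supNorm {d : ℕ} {K : (Fin d → ℝ) → ℝ} (hK : IsKernel K) (z : Fin d → ℝ) :
    K z ≤ supNorm K :=
  (le_abs_self _).trans (le_ciSup hK.bounded z)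

theorem IsKernel.integrable {d : ℕ} {K : (Fin d → ℝ) → ℝ} (hK : IsKernel K) : Integrable K := by
  by_contra h
  have := hK.integral_eq_one
  rw [integral_undef h] at this
  exact zero_ne_one this

theorem IsKernel.abs_mul_le {d : ℕ} {K : (Fin d → ℝ) → ℝ} (hK : IsKernel K)
    {φ : (Fin d → ℝ) → ℝ} {C : ℝ}
    (hC : ∀ z, (∀ j, z j ∈ Set.Icc (-(1 / 2) : ℝ) (1 / 2)) → |φ z| ≤ C) (z : Fin d → ℝ) :
    |φ z * K z| ≤ C * K z := by
  by_cases hz : K z = 0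
  · simp [hz]
  · rw [abs_mul, abs_of_nonneg (hK.nonneg z)]
    exact mul_le_mul_of_nonneg_right (hC z (hK.mem_of_ne_zero hz)) (hK.nonneg z)

theorem IsKernel.integrable_mul {d : ℕ} {K : (Fin d → ℝ) → ℝ} (hK : IsKernel K)
    {φ : (Fin d → ℝ) → ℝ} (hφ : Measurable φ) {C : ℝ}
    (hC : ∀ z, (∀ j, z j ∈ Set.Icc (-(1 / 2) : ℝ) (1 / 2)) → |φ z| ≤ C) :
    Integrable fun z => φ z * K z :=
  (hK.integrable.const_mul C).mono' (hφ.mul hK.measurable).aestronglyMeasurable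
    (ae_of_all _ (hK.abs_mul_le hC))

/-- The kernel has mass one on a cube of volume one. -/
theorem IsKernel.one_le_supNorm {d : ℕ} {K : (Fin d → ℝ) → ℝ} (hK : IsKernel K) :
    1 ≤ supNorm K := by
  set S : Set (Fin d → ℝ) := Set.Icc (fun _ => -(1 / 2)) (fun _ => 1 / 2) with hS
  have hvol : volume S = 1 := by
    rw [hS, Real.volume_Icc_pi]
    norm_num
  calc (1 : ℝ) = ∫ z in S, K z := by
        rw [← hK.integral_eq_one]
        refine (setIntegral_eq_integral_of_forall_compl_eq_zero fun z hz => ?_).symm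
        by_contra h
        exact hz ⟨fun j => (hK.mem_of_ne_zero h j).1, fun j => (hK.mem_of_ne_zero h j).2⟩
    _ ≤ ∫ z in S, supNorm K := by
        refine setIntegral_mono hK.integrable.integrableOn ?_ hK.le_supNorm
        exact integrableOn_const (by simp [hvol])
    _ = supNorm K := by simp [Measure.real, hvol]

theorem momentMatrix_apply {d b : ℕ} {K : (Fin d → ℝ) → ℝ} (hK : IsKernel K)
    (p q : multiIdx d b) :
    momentMatrix b K p q = ∫ z, monomial p.1 z * monomial q.1 z * K z := by
  refine setIntegral_eq_integral_of_forall_compl_eq_zero fun z hz => ?_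
  have : K z = 0 := by
    by_contra h
    exact hz (hK.mem_of_ne_zero h)
  simp [this]

theorem dotProduct_momentMatrix_mulVec {d b : ℕ} {K : (Fin d → ℝ) → ℝ} (hK : IsKernel K)
    (t : multiIdx d b → ℝ) :
    dotProduct t ((momentMatrix b K).mulVec t) = ∫ z, polyVal t z ^ 2 * K z := by
  have hexp : ∀ z, polyVal t z ^ 2 * K z =
      ∑ p, ∑ q, t p * (t q * (monomial p.1 z * monomial q.1 z * K z)) := by
    intro z
    rw [polyVal, sq, Finset.sum_mul_sum, Finset.sum_mul]
    refine Finset.sum_congr rfl fun p _ => ?_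
    rw [Finset.sum_mul]
    exact Finset.sum_congr rfl fun q _ => by ring
  have hint : ∀ p q : multiIdx d b, Integrable fun z =>
      monomial p.1 z * monomial q.1 z * K z := fun p q =>
    hK.integrable_mul (φ := fun z => monomial p.1 z * monomial q.1 z)
      ((measurable_monomial p.1).mul (measurable_monomial q.1)) (C := 1) fun z hz => by
        rw [abs_mul]
        exact mul_le_one₀ (abs_monomial_le_one _ hz) (abs_nonneg _) (abs_monomial_le_one _ hz)
  simp_rw [hexp]
  rw [integral_finsetSum _ fun p _ => integrable_finsetSum _ fun q _ =>
    ((hint p q).const_mul _).const_mul _]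
  simp_rw [dotProduct, Matrix.mulVec, dotProduct, Finset.mul_sum]
  refine Finset.sum_congr rfl fun p _ => ?_
  rw [integral_finsetSum _ fun q _ => ((hint p q).const_mul _).const_mul _]
  refine Finset.sum_congr rfl fun q _ => ?_
  rw [integral_const_mul, integral_const_mul, momentMatrix_apply hK]
  ring

/-- If the quadratic form `∫ (polyVal t)² K` vanished for some `t ≠ 0`, then `K = 0` almost
everywhere, because a nonzero polynomial has a null zero set; this contradicts `∫ K = 1`. -/
theorem momentMatrix_posDef {d b : ℕ} {K : (Fin d → ℝ) → ℝ} (hK : IsKernel K) :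
    (momentMatrix b K).PosDef := by
  refine Matrix.PosDef.of_dotProduct_mulVec_pos ?_ fun t ht => ?_
  · ext p q
    simp [momentMatrix, mul_comm (monomial q.1 _)]
  · rw [star_trivial, dotProduct_momentMatrix_mulVec hK]
    have hnn : ∀ z, 0 ≤ polyVal t z ^ 2 * K z := fun z => mul_nonneg (sq_nonneg _) (hK.nonneg z)
    refine lt_of_le_of_ne (integral_nonneg hnn) fun h => ?_
    have hint : Integrable fun z => polyVal t z ^ 2 * K z :=
      hK.integrable_mul ((measurable_polyVal t).pow_const 2) (C := (∑ p, |t p|) ^ 2) fun z hz => by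
        rw [abs_pow]
        exact pow_le_pow_left₀ (abs_nonneg _) (abs_polyVal_le t hz) 2
    have hae := (integral_eq_zero_iff_of_nonneg hnn hint).1 h.symm
    have hK0 : K =ᵐ[volume] 0 := by
      filter_upwards [hae, ae_polyVal_ne_zero ht] with z hz hne
      simpa [hne] using hz
    have := hK.integral_eq_one
    rw [integral_congr_ae hK0] at this
    simp at this

theorem _root_.Matrix.IsHermitian.sInf_spectrum_mul_le {ι : Type*} [Fintype ι] [DecidableEq ι]
    {A : Matrix ι ι ℝ} (hA : A.IsHermitian) (t : ι → ℝ) :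
    sInf (spectrum ℝ A) * ∑ i, t i ^ 2 ≤ dotProduct t (A.mulVec t) := by
  set l := sInf (spectrum ℝ A) with hl
  have hH : (A - algebraMap ℝ (Matrix ι ι ℝ) l).IsHermitian := by
    refine hA.sub ?_
    rw [Matrix.algebraMap_eq_diagonal]
    exact Matrix.isHermitian_diagonal _
  have hpsd : (A - algebraMap ℝ (Matrix ι ι ℝ) l).PosSemidef := by
    rw [hH.posSemidef_iff_eigenvalues_nonneg]
    intro i
    have hmem := hH.eigenvalues_mem_spectrum_real i
    rw [← spectrum.sub_singleton_eq] at hmem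
    obtain ⟨x, hx, y, hy, hxy⟩ := hmem
    simp only [Set.mem_singleton_iff] at hy
    have : l ≤ x := csInf_le A.finite_real_spectrum.bddBelow hx
    simp only [Pi.zero_apply]
    rw [← hxy, hy]
    simpa using this
  have h := hpsd.dotProduct_mulVec_nonneg t
  rw [star_trivial, Matrix.sub_mulVec, dotProduct_sub, Algebra.algebraMap_eq_smul_one,
    Matrix.smul_mulVec, Matrix.one_mulVec, dotProduct_smul, smul_eq_mul] at h
  have hdot : dotProduct t t = ∑ i, t i ^ 2 := Finset.sum_congr rfl fun i _ => (sq _).symm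
  rw [hdot] at h
  linarith

theorem minEigen_mul_le {d b : ℕ} {K : (Fin d → ℝ) → ℝ} (hK : IsKernel K)
    (t : multiIdx d b → ℝ) :
    minEigen b K * ∑ p, t p ^ 2 ≤ ∫ z, polyVal t z ^ 2 * K z := by
  rw [← dotProduct_momentMatrix_mulVec hK]
  exact (momentMatrix_posDef hK).isHermitian.sInf_spectrum_mul_le t

theorem minEigen_pos {d : ℕ} (b : ℕ) {K : (Fin d → ℝ) → ℝ} (hK : IsKernel K) :
    0 < minEigen b K := by
  have hA := momentMatrix_posDef (b := b) hK
  have hne : (spectrum ℝ (momentMatrix b K)).Nonempty :=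
    ⟨_, hA.isHermitian.eigenvalues_mem_spectrum_real (zeroIdx d b)⟩
  -- The spectrum is finite and nonempty, so the infimum is an eigenvalue and inherits positivity.
  have hmem : minEigen b K ∈ spectrum ℝ (momentMatrix b K) :=
    hne.csInf_mem (Matrix.finite_real_spectrum)
  rw [hA.isHermitian.spectrum_real_eq_range_eigenvalues] at hmem
  obtain ⟨i, hi⟩ := hmem
  rw [← hi]
  exact hA.eigenvalues_pos i

/-! ### The averaged score -/

/-- The law on `ℝ` with density `g`. -/
def noiseLaw (g : ℝ → ℝ) : Measure ℝ := volume.withDensity fun z => ENNReal.ofReal (g z)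

theorem IsSymmMonotoneDensity.isProbabilityMeasure {g : ℝ → ℝ} (hg : IsSymmMonotoneDensity g) :
    IsProbabilityMeasure (noiseLaw g) :=
  ⟨by rw [noiseLaw, withDensity_apply _ MeasurableSet.univ, Measure.restrict_univ,
    hg.lintegral_eq_one]⟩

theorem IsSymmMonotoneDensity.integral_noiseLaw {g : ℝ → ℝ} (hg : IsSymmMonotoneDensity g)
    (φ : ℝ → ℝ) : ∫ z, φ z ∂noiseLaw g = ∫ z, φ z * g z := by
  rw [noiseLaw, integral_withDensity_eq_integral_toReal_smul hg.measurable.ennreal_ofReal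
    (ae_of_all _ fun _ => ENNReal.ofReal_lt_top)]
  refine integral_congr_ae (ae_of_all _ fun z => ?_)
  simp [ENNReal.toReal_ofReal (hg.nonneg z), mul_comm]

theorem IsContrast.deriv_neg {ρ : ℝ → ℝ} (hρ : IsContrast ρ) (z : ℝ) :
    deriv ρ (-z) = -deriv ρ z := by
  have h : deriv (fun x => ρ (-x)) z = -deriv ρ (-z) := deriv_comp_neg ρ z
  have h' : (fun x => ρ (-x)) = ρ := funext hρ.symm
  rw [h'] at h
  linarith

theorem IsContrast.abs_deriv_le {ρ : ℝ → ℝ} (hρ : IsContrast ρ) (z : ℝ) :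
    |deriv ρ z| ≤ supNorm (deriv ρ) := le_ciSup hρ.deriv_bounded z

theorem IsContrast.abs_deriv_sub_le {ρ : ℝ → ℝ} (hρ : IsContrast ρ) (u v : ℝ) :
    |deriv ρ u - deriv ρ v| ≤ |u - v| := by
  simpa [Real.dist_eq] using hρ.deriv_lipschitz.dist_le_mul u v

/-- Valid at every point: where `ρ'` is not differentiable, `deriv` returns `0`. -/
theorem IsContrast.abs_deriv_deriv_le {ρ : ℝ → ℝ} (hρ : IsContrast ρ) (z : ℝ) :
    |deriv (deriv ρ) z| ≤ 1 := by
  simpa using norm_deriv_le_of_lipschitz hρ.deriv_lipschitz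

/-- A Lipschitz function is absolutely continuous, so the fundamental theorem of calculus survives
although `ρ''` exists only almost everywhere. -/
theorem IsContrast.integral_deriv_deriv {ρ : ℝ → ℝ} (hρ : IsContrast ρ) (z w : ℝ) :
    ∫ v in (0 : ℝ)..w, deriv (deriv ρ) (z + v) = deriv ρ (z + w) - deriv ρ z := by
  have h := (hρ.deriv_lipschitz.lipschitzOnWith (s := Set.uIcc z (z + w))
    ).absolutelyContinuousOnInterval.integral_deriv_eq_sub
  rw [← h, intervalIntegral.integral_comp_add_left (fun x => deriv (deriv ρ) x) z, add_zero]

/-- The averaged score `w ↦ ∫ ρ'(z + w) g(z) dz`. -/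
def meanScore (ρ g : ℝ → ℝ) (w : ℝ) : ℝ := ∫ z, deriv ρ (z + w) ∂noiseLaw g

section

variable {ρ g : ℝ → ℝ}

theorem integrable_deriv_add (hρ : IsContrast ρ) (hg : IsSymmMonotoneDensity g) (w : ℝ) :
    Integrable (fun z => deriv ρ (z + w)) (noiseLaw g) := by
  have := hg.isProbabilityMeasure
  refine Integrable.of_bound
    ((measurable_deriv ρ).comp (measurable_add_const w)).aestronglyMeasurable
    (supNorm (deriv ρ)) (ae_of_all _ fun z => hρ.abs_deriv_le _)

theorem integrable_deriv_deriv_add (hρ : IsContrast ρ) (hg : IsSymmMonotoneDensity g) (w : ℝ) :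
    Integrable (fun z => deriv (deriv ρ) (z + w)) (noiseLaw g) := by
  have := hg.isProbabilityMeasure
  refine Integrable.of_bound
    ((measurable_deriv (deriv ρ)).comp (measurable_add_const w)).aestronglyMeasurable
    1 (ae_of_all _ fun z => hρ.abs_deriv_deriv_le _)

/-- `ρ'` is odd and `g` is even. In particular the averaged score vanishes at zero: without bias,
`θ` is a zero of the expected score. -/
theorem meanScore_neg (hρ : IsContrast ρ) (hg : IsSymmMonotoneDensity g) (w : ℝ) :
    meanScore ρ g (-w) = -meanScore ρ g w := by
  rw [meanScore, meanScore, hg.integral_noiseLaw, hg.integral_noiseLaw,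
    ← integral_neg_eq_self, ← integral_neg]
  refine integral_congr_ae (ae_of_all _ fun z => ?_)
  simp only
  rw [hg.symm, ← neg_add, hρ.deriv_neg, neg_mul]

theorem meanScore_zero (hρ : IsContrast ρ) (hg : IsSymmMonotoneDensity g) : meanScore ρ g 0 = 0 := by
  have := meanScore_neg hρ hg 0
  rw [neg_zero] at this
  linarith

theorem abs_meanScore_sub_le (hρ : IsContrast ρ) (hg : IsSymmMonotoneDensity g) (u v : ℝ) :
    |meanScore ρ g u - meanScore ρ g v| ≤ |u - v| := by
  have := hg.isProbabilityMeasure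
  rw [meanScore, meanScore, ← integral_sub (integrable_deriv_add hρ hg u)
    (integrable_deriv_add hρ hg v)]
  have := norm_integral_le_of_norm_le_const (μ := noiseLaw g)
    (f := fun z => deriv ρ (z + u) - deriv ρ (z + v)) (C := |u - v|)
    (ae_of_all _ fun z => (hρ.abs_deriv_sub_le _ _).trans (by rw [add_sub_add_left_eq_sub]))
  simpa using this

theorem meanScore_eq_integral (hρ : IsContrast ρ) (hg : IsSymmMonotoneDensity g) {w : ℝ} (hw : 0 ≤ w) :
    meanScore ρ g w = ∫ v in (0 : ℝ)..w, ∫ z, deriv (deriv ρ) (z + v) ∂noiseLaw g := by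
  have := hg.isProbabilityMeasure
  have hsub : meanScore ρ g w = ∫ z, (∫ v in (0 : ℝ)..w, deriv (deriv ρ) (z + v)) ∂noiseLaw g := by
    simp_rw [hρ.integral_deriv_deriv]
    have h0 : ∫ z, deriv ρ z ∂noiseLaw g = 0 := by simpa [meanScore] using meanScore_zero hρ hg
    have hi : Integrable (fun z => deriv ρ z) (noiseLaw g) := by
      simpa using integrable_deriv_add hρ hg 0
    rw [integral_sub (integrable_deriv_add hρ hg w) hi, h0, sub_zero, meanScore]
  rw [hsub]
  simp_rw [intervalIntegral.integral_of_le hw]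
  refine integral_integral_swap (f := fun z v => deriv (deriv ρ) (z + v)) ?_
  refine Integrable.of_bound
    ((measurable_deriv (deriv ρ)).comp measurable_add).aestronglyMeasurable
    1 (ae_of_all _ fun z => hρ.abs_deriv_deriv_le _)

/-- The averaged second derivative is at least `c` at zero, and the Hölder condition lets it drop by
at most `L w₀^α ≤ c/2` on `[0, w₀]`; integration over `[0, w]` gives the slope. -/
theorem mul_le_meanScore (hρ : IsContrast ρ) (hg : IsSymmMonotoneDensity g)
    {L α c w₀ w : ℝ} (hL : 0 < L) (hα : 0 < α)
    (hHol : ∀ u v : ℝ, ∫ z, |deriv (deriv ρ) (z + u) - deriv (deriv ρ) (z + v)| * g z ≤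
      L * |u - v| ^ α)
    (hc : c ≤ ∫ z, deriv (deriv ρ) z * g z) (hw₀ : L * w₀ ^ α ≤ c / 2) (hw : 0 ≤ w)
    (hww : w ≤ w₀) : c / 2 * w ≤ meanScore ρ g w := by
  have := hg.isProbabilityMeasure
  have hlow : ∀ v ∈ Set.Icc 0 w, c / 2 ≤ ∫ z, deriv (deriv ρ) (z + v) ∂noiseLaw g := by
    intro v hv
    have h1 : |∫ z, (deriv (deriv ρ) (z + v) - deriv (deriv ρ) (z + 0)) ∂noiseLaw g| ≤
        L * |v - 0| ^ α := by
      refine (abs_integral_le_integral_abs).trans ?_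
      rw [hg.integral_noiseLaw]
      exact hHol v 0
    rw [integral_sub (integrable_deriv_deriv_add hρ hg v) (integrable_deriv_deriv_add hρ hg 0)] at h1
    simp only [add_zero, sub_zero] at h1
    rw [hg.integral_noiseLaw (fun z => deriv (deriv ρ) z), abs_of_nonneg hv.1] at h1
    have h2 : L * v ^ α ≤ L * w₀ ^ α := by
      gcongr
      · exact hv.1
      · exact hv.2.trans hww
    have h3 := (abs_le.1 h1).1
    linarith
  rw [meanScore_eq_integral hρ hg hw]
  have hmeas : Measurable fun v => ∫ z, deriv (deriv ρ) (z + v) ∂noiseLaw g := by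
    have : StronglyMeasurable (Function.uncurry fun v z : ℝ => deriv (deriv ρ) (z + v)) :=
      ((measurable_deriv (deriv ρ)).comp (measurable_snd.add measurable_fst)).stronglyMeasurable
    exact this.integral_prod_right.measurable
  have hii : IntervalIntegrable (fun v => ∫ z, deriv (deriv ρ) (z + v) ∂noiseLaw g) volume 0 w := by
    rw [intervalIntegrable_iff, Set.uIoc_of_le hw]
    refine Integrable.of_bound hmeas.aestronglyMeasurable 1 (ae_of_all _ fun v => ?_)
    have := norm_integral_le_of_norm_le_const (μ := noiseLaw g)
      (f := fun z => deriv (deriv ρ) (z + v)) (C := 1)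
      (ae_of_all _ fun z => hρ.abs_deriv_deriv_le _)
    simpa using this
  calc c / 2 * w = ∫ v in (0 : ℝ)..w, c / 2 := by
        rw [intervalIntegral.integral_const, smul_eq_mul, sub_zero, mul_comm]
    _ ≤ _ := intervalIntegral.integral_mono_on hw (by simp) hii hlow

/-- Near the origin the averaged score has slope at least `c / 2`. -/
theorem mul_sq_le_mul_meanScore (hρ : IsContrast ρ) (hg : IsSymmMonotoneDensity g)
    {L α c w₀ w : ℝ} (hL : 0 < L) (hα : 0 < α)
    (hHol : ∀ u v : ℝ, ∫ z, |deriv (deriv ρ) (z + u) - deriv (deriv ρ) (z + v)| * g z ≤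
      L * |u - v| ^ α)
    (hc : c ≤ ∫ z, deriv (deriv ρ) z * g z) (hw₀ : L * w₀ ^ α ≤ c / 2) (hww : |w| ≤ w₀) :
    c / 2 * w ^ 2 ≤ w * meanScore ρ g w := by
  rcases le_total 0 w with hw | hw
  · have := mul_le_meanScore hρ hg hL hα hHol hc hw₀ hw (by rwa [abs_of_nonneg hw] at hww)
    nlinarith
  · have := mul_le_meanScore hρ hg hL hα hHol hc hw₀ (neg_nonneg.2 hw)
      (by rwa [abs_of_nonpos hw] at hww)
    rw [meanScore_neg hρ hg] at this
    nlinarith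

end

/-! ### The rescaled design -/

/-- The rescaled point `(x - x₀) / h`. -/
def rescale {d : ℕ} (x₀ : Fin d → ℝ) (h : ℝ) (x : Fin d → ℝ) : Fin d → ℝ :=
  fun j => (x j - x₀ j) / h

theorem measurable_rescale {d : ℕ} (x₀ : Fin d → ℝ) (h : ℝ) : Measurable (rescale x₀ h) := by
  unfold rescale
  fun_prop

theorem rescale_eq_smul {d : ℕ} (x₀ : Fin d → ℝ) (h : ℝ) (x : Fin d → ℝ) :
    rescale x₀ h x = h⁻¹ • (x - x₀) := by
  ext j
  simp [rescale, div_eq_inv_mul]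

theorem measurableSet_unitCube (d : ℕ) : MeasurableSet (unitCube d) := measurableSet_Icc

theorem measurableSet_nbhd {d : ℕ} (x₀ : Fin d → ℝ) (h : ℝ) : MeasurableSet (nbhd x₀ h) := by
  refine MeasurableSet.inter ?_ (measurableSet_unitCube d)
  have : {x : Fin d → ℝ | ∀ j, x j ∈ Set.Icc (x₀ j - h / 2) (x₀ j + h / 2)} =
      Set.Icc (fun j => x₀ j - h / 2) (fun j => x₀ j + h / 2) := by
    ext x
    exact ⟨fun hx => ⟨fun j => (hx j).1, fun j => (hx j).2⟩, fun hx j => ⟨hx.1 j, hx.2 j⟩⟩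
  rw [this]
  exact measurableSet_Icc

theorem localPoly_of_mem {d b : ℕ} {x₀ : Fin d → ℝ} {h : ℝ} (t : multiIdx d b → ℝ)
    {x : Fin d → ℝ} (hx : x ∈ nbhd x₀ h) : localPoly x₀ h t x = polyVal t (rescale x₀ h x) :=
  Set.indicator_of_mem hx _

theorem measurable_localPoly {d b : ℕ} (x₀ : Fin d → ℝ) (h : ℝ) (t : multiIdx d b → ℝ) :
    Measurable (localPoly x₀ h t) :=
  ((measurable_polyVal t).comp (measurable_rescale x₀ h)).indicator (measurableSet_nbhd x₀ h)

/-- The kernel window around `x₀` with bandwidth `h` lies in the unit cube. -/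
def WindowInCube {d : ℕ} (K : (Fin d → ℝ) → ℝ) (x₀ : Fin d → ℝ) (h : ℝ) : Prop :=
  ∀ z, K z ≠ 0 → x₀ + h • z ∈ unitCube d

theorem WindowInCube.mem_nbhd {d : ℕ} {K : (Fin d → ℝ) → ℝ} (hK : IsKernel K)
    {x₀ : Fin d → ℝ} {h : ℝ} (hw : WindowInCube K x₀ h) (hh : 0 < h) {x : Fin d → ℝ}
    (hx : K (rescale x₀ h x) ≠ 0) : x ∈ nbhd x₀ h := by
  have hx' : x₀ + h • rescale x₀ h x = x := by
    ext j
    simp only [rescale, Pi.add_apply, Pi.smul_apply, smul_eq_mul]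
    field_simp
    ring
  refine ⟨fun j => ?_, hx' ▸ hw _ hx⟩
  have hj := hK.mem_of_ne_zero hx j
  simp only [rescale, Set.mem_Icc, le_div_iff₀ hh, div_le_iff₀ hh] at hj ⊢
  constructor <;> linarith [hj.1, hj.2]

/-- The window stays in the cube, so no part of the kernel is cut off and the change of variables
gives the full integral. -/
theorem setIntegral_comp_rescale {d : ℕ} {K : (Fin d → ℝ) → ℝ}
    {x₀ : Fin d → ℝ} {h : ℝ} (hK : IsKernel K) (hw : WindowInCube K x₀ h) (hh : 0 < h)
    (φ : (Fin d → ℝ) → ℝ) :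
    ∫ x in unitCube d, φ (rescale x₀ h x) * K (rescale x₀ h x) = h ^ d * ∫ z, φ z * K z := by
  rw [setIntegral_eq_integral_of_forall_compl_eq_zero fun x hx => ?_]
  · simp_rw [rescale_eq_smul]
    rw [integral_sub_right_eq_self (fun x => φ (h⁻¹ • x) * K (h⁻¹ • x)) x₀,
      Measure.integral_comp_inv_smul volume (fun x => φ x * K x) h]
    simp [abs_of_pos hh]
  · have : K (rescale x₀ h x) = 0 := by
      by_contra hne
      exact hx (hw.mem_nbhd hK hh hne).2
    simp [this]

section

variable {Ω : Type*} [MeasurableSpace Ω] {P : Measure Ω} {d : ℕ} {K : (Fin d → ℝ) → ℝ}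
  {x₀ : Fin d → ℝ} {h : ℝ} {X : Ω → Fin d → ℝ}

theorem integral_design (hK : IsKernel K) (hw : WindowInCube K x₀ h) (hh : 0 < h)
    (hX : Measurable X) (hlaw : P.map X = volume.restrict (unitCube d))
    {φ : (Fin d → ℝ) → ℝ} (hφ : Measurable φ) :
    ∫ ω, φ (rescale x₀ h (X ω)) * K (rescale x₀ h (X ω)) ∂P = h ^ d * ∫ z, φ z * K z := by
  rw [← setIntegral_comp_rescale hK hw hh φ, ← hlaw]
  refine (integral_map hX.aemeasurable ?_ (f := fun x =>
    φ (rescale x₀ h x) * K (rescale x₀ h x))).symm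
  exact ((hφ.mul hK.measurable).comp (measurable_rescale x₀ h)).aestronglyMeasurable

theorem integral_kernel_design (hK : IsKernel K) (hw : WindowInCube K x₀ h) (hh : 0 < h)
    (hX : Measurable X) (hlaw : P.map X = volume.restrict (unitCube d)) :
    ∫ ω, K (rescale x₀ h (X ω)) ∂P = h ^ d := by
  have := integral_design hK hw hh hX hlaw (φ := fun _ => 1) measurable_const
  simpa [hK.integral_eq_one] using this

/-- Only one of the two factors `K` is replaced by its supremum; the other is integrated and
supplies `h^d`. -/
theorem integral_sq_le_of_abs_le [IsProbabilityMeasure P] (hK : IsKernel K)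
    (hw : WindowInCube K x₀ h) (hh : 0 < h)
    (hX : Measurable X) (hlaw : P.map X = volume.restrict (unitCube d)) {Y : Ω → ℝ} {A : ℝ}
    (hY : ∀ ω, |Y ω| ≤ A * K (rescale x₀ h (X ω))) :
    ∫ ω, Y ω ^ 2 ∂P ≤ A ^ 2 * supNorm K * h ^ d := by
  have hmK : Measurable fun ω => K (rescale x₀ h (X ω)) :=
    hK.measurable.comp ((measurable_rescale x₀ h).comp hX)
  have hiK : Integrable (fun ω => K (rescale x₀ h (X ω))) P :=
    Integrable.of_bound hmK.aestronglyMeasurable (supNorm K) (ae_of_all _ fun ω => by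
      rw [Real.norm_eq_abs, abs_of_nonneg (hK.nonneg _)]
      exact hK.le_supNorm _)
  calc ∫ ω, Y ω ^ 2 ∂P ≤ ∫ ω, A ^ 2 * supNorm K * K (rescale x₀ h (X ω)) ∂P := by
        refine integral_mono_of_nonneg (ae_of_all _ fun ω => sq_nonneg _) (hiK.const_mul _)
          (ae_of_all _ fun ω => ?_)
        simp only
        calc Y ω ^ 2 = |Y ω| ^ 2 := (sq_abs _).symm
          _ ≤ (A * K (rescale x₀ h (X ω))) ^ 2 := pow_le_pow_left₀ (abs_nonneg _) (hY ω) 2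
          _ = A ^ 2 * (K (rescale x₀ h (X ω)) * K (rescale x₀ h (X ω))) := by ring
          _ ≤ A ^ 2 * (supNorm K * K (rescale x₀ h (X ω))) := by
            gcongr
            · exact hK.nonneg _
            · exact hK.le_supNorm _
          _ = _ := by ring
    _ = _ := by rw [integral_const_mul, integral_kernel_design hK hw hh hX hlaw]

/-- Independence allows the noise to be integrated first at a frozen design point, which replaces
`ρ'` by the averaged score. -/
theorem integral_prodMk_eq [IsProbabilityMeasure P] {g : ℝ → ℝ} {ξ : Ω → ℝ}
    (hX : Measurable X) (hξ : Measurable ξ) (hlawξ : P.map ξ = noiseLaw g)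
    (hind : IndepFun X ξ P) {Φ : (Fin d → ℝ) × ℝ → ℝ} (hΦ : Measurable Φ) {C : ℝ}
    (hC : ∀ y, |Φ y| ≤ C) :
    ∫ ω, Φ (X ω, ξ ω) ∂P = ∫ ω, ∫ z, Φ (X ω, z) ∂noiseLaw g ∂P := by
  have hpX : IsProbabilityMeasure (P.map X) := Measure.isProbabilityMeasure_map hX.aemeasurable
  have hpξ : IsProbabilityMeasure (P.map ξ) := Measure.isProbabilityMeasure_map hξ.aemeasurable
  have hjoint := (indepFun_iff_map_prod_eq_prod_map_map hX.aemeasurable hξ.aemeasurable).1 hind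
  have hint : Integrable Φ ((P.map X).prod (P.map ξ)) :=
    Integrable.of_bound hΦ.aestronglyMeasurable C (ae_of_all _ hC)
  calc ∫ ω, Φ (X ω, ξ ω) ∂P = ∫ y, Φ y ∂((P.map X).prod (P.map ξ)) := by
        rw [← hjoint]
        exact (integral_map (hX.prodMk hξ).aemeasurable hΦ.aestronglyMeasurable).symm
    _ = ∫ x, ∫ z, Φ (x, z) ∂(P.map ξ) ∂(P.map X) := integral_prod _ hint
    _ = ∫ ω, ∫ z, Φ (X ω, z) ∂(P.map ξ) ∂P := by
        refine integral_map hX.aemeasurable ?_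
        exact (hΦ.stronglyMeasurable.integral_prod_right' (ν := P.map ξ)).aestronglyMeasurable
    _ = _ := by rw [hlawξ]

end

/-! ### Score terms -/

/-- The contribution of one observation `(x, ξ)` to the `p`-th component of the score at `t`. -/
def scoreTerm {d b : ℕ} (ρ : ℝ → ℝ) (K : (Fin d → ℝ) → ℝ) (x₀ : Fin d → ℝ) (h : ℝ)
    (f : (Fin d → ℝ) → ℝ) (t : multiIdx d b → ℝ) (p : multiIdx d b) (y : (Fin d → ℝ) × ℝ) : ℝ :=
  deriv ρ (f y.1 + y.2 - localPoly x₀ h t y.1) * monomial p.1 (rescale x₀ h y.1) *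
    K (rescale x₀ h y.1)

section

variable {d b : ℕ} {ρ : ℝ → ℝ} {K : (Fin d → ℝ) → ℝ} {x₀ : Fin d → ℝ} {h : ℝ}
  {f : (Fin d → ℝ) → ℝ}

theorem measurable_scoreTerm (hK : IsKernel K) (hf : Measurable f) (t : multiIdx d b → ℝ)
    (p : multiIdx d b) : Measurable (scoreTerm ρ K x₀ h f t p) := by
  have h1 : Measurable fun y : (Fin d → ℝ) × ℝ => f y.1 + y.2 - localPoly x₀ h t y.1 :=
    ((hf.comp measurable_fst).add measurable_snd).sub
      ((measurable_localPoly x₀ h t).comp measurable_fst)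
  have h2 : Measurable fun y : (Fin d → ℝ) × ℝ => rescale x₀ h y.1 :=
    (measurable_rescale x₀ h).comp measurable_fst
  exact (((measurable_deriv ρ).comp h1).mul ((measurable_monomial p.1).comp h2)).mul
    (hK.measurable.comp h2)

theorem abs_scoreTerm_le (hK : IsKernel K) (hρ : IsContrast ρ) (t : multiIdx d b → ℝ)
    (p : multiIdx d b) (y : (Fin d → ℝ) × ℝ) :
    |scoreTerm ρ K x₀ h f t p y| ≤ supNorm (deriv ρ) * K (rescale x₀ h y.1) := by
  by_cases hz : K (rescale x₀ h y.1) = 0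
  · simp [scoreTerm, hz]
  · rw [scoreTerm, abs_mul, abs_of_nonneg (hK.nonneg _), abs_mul]
    refine mul_le_mul_of_nonneg_right ?_ (hK.nonneg _)
    exact (mul_le_of_le_one_right (abs_nonneg _)
      (abs_monomial_le_one _ (hK.mem_of_ne_zero hz))).trans (hρ.abs_deriv_le _)

theorem abs_scoreTerm_sub_le (hK : IsKernel K) (hρ : IsContrast ρ) (hw : WindowInCube K x₀ h)
    (hh : 0 < h) (s t : multiIdx d b → ℝ) (p : multiIdx d b) (y : (Fin d → ℝ) × ℝ) :
    |scoreTerm ρ K x₀ h f s p y - scoreTerm ρ K x₀ h f t p y| ≤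
      (∑ q, |s q - t q|) * K (rescale x₀ h y.1) := by
  by_cases hz : K (rescale x₀ h y.1) = 0
  · simp [scoreTerm, hz]
  · have hmem := hK.mem_of_ne_zero hz
    have hy := hw.mem_nbhd hK hh hz
    rw [scoreTerm, scoreTerm, ← sub_mul, ← sub_mul, abs_mul, abs_of_nonneg (hK.nonneg _), abs_mul]
    refine mul_le_mul_of_nonneg_right ?_ (hK.nonneg _)
    refine (mul_le_of_le_one_right (abs_nonneg _) (abs_monomial_le_one _ hmem)).trans ?_
    refine (hρ.abs_deriv_sub_le _ _).trans ?_
    rw [localPoly_of_mem s hy, localPoly_of_mem t hy, sub_sub_sub_cancel_left, abs_sub_comm]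
    have : polyVal s (rescale x₀ h y.1) - polyVal t (rescale x₀ h y.1) =
        polyVal (s - t) (rescale x₀ h y.1) := by
      simp [polyVal, ← Finset.sum_sub_distrib, sub_mul]
    rw [this]
    exact abs_polyVal_le (s - t) hmem

theorem sum_mul_scoreTerm (s t : multiIdx d b → ℝ) (y : (Fin d → ℝ) × ℝ) :
    ∑ p, s p * scoreTerm ρ K x₀ h f t p y =
      deriv ρ (f y.1 + y.2 - localPoly x₀ h t y.1) * polyVal s (rescale x₀ h y.1) *
        K (rescale x₀ h y.1) := by
  rw [polyVal, Finset.mul_sum, Finset.sum_mul]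
  exact Finset.sum_congr rfl fun p _ => by rw [scoreTerm]; ring

/-- The expected score in direction `s` at `θ + s`. -/
theorem integral_sum_mul_scoreTerm_le {Ω : Type*} [MeasurableSpace Ω] {P : Measure Ω}
    [IsProbabilityMeasure P] (hK : IsKernel K) (hρ : IsContrast ρ) (hw : WindowInCube K x₀ h)
    (hh : 0 < h) (hf : Measurable f) {g : ℝ → ℝ} (hg : IsSymmMonotoneDensity g)
    {X : Ω → Fin d → ℝ} {ξ : Ω → ℝ}
    (hX : Measurable X) (hlaw : P.map X = volume.restrict (unitCube d))
    (hξ : Measurable ξ) (hlawξ : P.map ξ = noiseLaw g) (hind : IndepFun X ξ P)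
    {L α c w₀ : ℝ} (hL : 0 < L) (hα : 0 < α) (hc0 : 0 < c)
    (hHol : ∀ u v : ℝ, ∫ z, |deriv (deriv ρ) (z + u) - deriv (deriv ρ) (z + v)| * g z ≤
      L * |u - v| ^ α)
    (hc : c ≤ ∫ z, deriv (deriv ρ) z * g z) (hw₀ : L * w₀ ^ α ≤ c / 2)
    {θ s : multiIdx d b → ℝ} {β : ℝ} (hβ0 : 0 ≤ β)
    (hβ : ∀ x ∈ nbhd x₀ h, |f x - localPoly x₀ h θ x| ≤ β) (hs : ∑ p, |s p| ≤ w₀) :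
    ∫ ω, ∑ p, s p * scoreTerm ρ K x₀ h f (θ + s) p (X ω, ξ ω) ∂P ≤
      h ^ d * (β * ∑ p, |s p| - c / 2 * (minEigen b K * ∑ p, s p ^ 2)) := by
  set S := ∑ p, |s p| with hS
  have hS0 : 0 ≤ S := Finset.sum_nonneg fun _ _ => abs_nonneg _
  have hprob := hg.isProbabilityMeasure
  have hmeas : Measurable fun y => ∑ p, s p * scoreTerm ρ K x₀ h f (θ + s) p y :=
    Finset.measurable_sum _ fun p _ => (measurable_scoreTerm hK hf _ p).const_mul _
  have hbound : ∀ y, |∑ p, s p * scoreTerm ρ K x₀ h f (θ + s) p y| ≤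
      S * (supNorm (deriv ρ) * supNorm K) := by
    intro y
    refine (Finset.abs_sum_le_sum_abs _ _).trans ?_
    rw [hS, Finset.sum_mul]
    refine Finset.sum_le_sum fun p _ => ?_
    rw [abs_mul]
    refine mul_le_mul_of_nonneg_left ((abs_scoreTerm_le hK hρ _ p y).trans ?_) (abs_nonneg _)
    exact mul_le_mul_of_nonneg_left (hK.le_supNorm _)
      ((abs_nonneg _).trans (hρ.abs_deriv_le 0))
  have hpt : ∀ x, ∫ z, ∑ p, s p * scoreTerm ρ K x₀ h f (θ + s) p (x, z) ∂noiseLaw g ≤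
      β * S * K (rescale x₀ h x) -
        c / 2 * (polyVal s (rescale x₀ h x) ^ 2 * K (rescale x₀ h x)) := by
    intro x
    simp_rw [sum_mul_scoreTerm]
    by_cases hz : K (rescale x₀ h x) = 0
    · simp [hz]
    · have hmem := hK.mem_of_ne_zero hz
      have hx := hw.mem_nbhd hK hh hz
      set q := polyVal s (rescale x₀ h x) with hq
      have hqS : |q| ≤ S := abs_polyVal_le s hmem
      have hadd : localPoly x₀ h (θ + s) x = localPoly x₀ h θ x + q := by
        rw [localPoly_of_mem _ hx, localPoly_of_mem _ hx, hq]
        simp [polyVal, add_mul, Finset.sum_add_distrib]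
      have hint : ∫ z, deriv ρ (f x + z - localPoly x₀ h (θ + s) x) * q * K (rescale x₀ h x)
          ∂noiseLaw g = meanScore ρ g (f x - localPoly x₀ h θ x - q) * q * K (rescale x₀ h x) := by
        rw [integral_mul_const, integral_mul_const, meanScore, hadd]
        congr 3
        ext z
        congr 1
        ring
      rw [hint]
      -- The Lipschitz bound strips off the approximation error. The slope bound is then needed only
      -- at `-q`, so the bias itself need not be small.
      have h1 := abs_meanScore_sub_le hρ hg (f x - localPoly x₀ h θ x - q) (-q)
      rw [sub_neg_eq_add, sub_add_cancel] at h1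
      have h2 := mul_sq_le_mul_meanScore hρ hg hL hα hHol hc hw₀ (hqS.trans hs)
      have h3 : (meanScore ρ g (f x - localPoly x₀ h θ x - q) - meanScore ρ g (-q)) * q ≤ β * S := by
        refine (le_abs_self _).trans ?_
        rw [abs_mul]
        exact mul_le_mul (h1.trans (hβ x hx)) hqS (abs_nonneg _) hβ0
      rw [meanScore_neg hρ hg] at h3
      have h4 : meanScore ρ g (f x - localPoly x₀ h θ x - q) * q ≤ β * S - c / 2 * q ^ 2 := by
        nlinarith
      calc _ ≤ (β * S - c / 2 * q ^ 2) * K (rescale x₀ h x) :=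
            mul_le_mul_of_nonneg_right h4 (hK.nonneg _)
        _ = _ := by ring
  have hmK : Measurable fun ω => K (rescale x₀ h (X ω)) :=
    hK.measurable.comp ((measurable_rescale x₀ h).comp hX)
  have hiK : Integrable (fun ω => K (rescale x₀ h (X ω))) P :=
    Integrable.of_bound hmK.aestronglyMeasurable (supNorm K) (ae_of_all _ fun ω => by
      rw [Real.norm_eq_abs, abs_of_nonneg (hK.nonneg _)]
      exact hK.le_supNorm _)
  have hiq : Integrable (fun ω => polyVal s (rescale x₀ h (X ω)) ^ 2 *
      K (rescale x₀ h (X ω))) P := by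
    refine (hiK.const_mul (S ^ 2)).mono' ?_ (ae_of_all _ fun ω => ?_)
    · exact ((((measurable_polyVal s).pow_const 2).mul hK.measurable).comp
        ((measurable_rescale x₀ h).comp hX)).aestronglyMeasurable
    · refine hK.abs_mul_le (φ := fun z => polyVal s z ^ 2) (fun z hz => ?_) _
      rw [abs_pow]
      exact pow_le_pow_left₀ (abs_nonneg _) (abs_polyVal_le s hz) 2
  have hinner : Integrable (fun ω => ∫ z, ∑ p, s p * scoreTerm ρ K x₀ h f (θ + s) p (X ω, z)
      ∂noiseLaw g) P := by
    refine Integrable.of_bound ?_ (S * (supNorm (deriv ρ) * supNorm K)) (ae_of_all _ fun ω => ?_)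
    · exact ((hmeas.stronglyMeasurable.integral_prod_right' (ν := noiseLaw g)).measurable.comp
        hX).aestronglyMeasurable
    · have := norm_integral_le_of_norm_le_const (μ := noiseLaw g)
        (f := fun z => ∑ p, s p * scoreTerm ρ K x₀ h f (θ + s) p (X ω, z))
        (ae_of_all _ fun z => hbound (X ω, z))
      simpa using this
  rw [integral_prodMk_eq hX hξ hlawξ hind hmeas hbound]
  calc _ ≤ ∫ ω, (β * S * K (rescale x₀ h (X ω)) - c / 2 *
          (polyVal s (rescale x₀ h (X ω)) ^ 2 * K (rescale x₀ h (X ω)))) ∂P :=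
        integral_mono hinner ((hiK.const_mul _).sub (hiq.const_mul _)) fun ω => hpt (X ω)
    _ = h ^ d * (β * S - c / 2 * ∫ z, polyVal s z ^ 2 * K z) := by
        rw [integral_sub (hiK.const_mul _) (hiq.const_mul _), integral_const_mul,
          integral_const_mul, integral_kernel_design hK hw hh hX hlaw,
          integral_design hK hw hh hX hlaw (φ := fun z => polyVal s z ^ 2)
            ((measurable_polyVal s).pow_const 2)]
        ring
    _ ≤ _ := by
        gcongr
        exact minEigen_mul_le hK s

end

/-! ### First-order condition for the estimator -/

theorem _root_.ConvexOn.add_deriv_mul_sub_le {ρ : ℝ → ℝ} (hρ : ConvexOn ℝ Set.univ ρ)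
    (hd : Differentiable ℝ ρ) (u v : ℝ) : ρ v + deriv ρ v * (u - v) ≤ ρ u := by
  rcases lt_trichotomy u v with h | h | h
  · have := hρ.slope_le_deriv (Set.mem_univ u) (Set.mem_univ v) h (hd v)
    rw [slope_def_field, div_le_iff₀ (sub_pos.2 h)] at this
    linarith
  · simp [h]
  · have := hρ.deriv_le_slope (Set.mem_univ v) (Set.mem_univ u) h (hd v)
    rw [slope_def_field, le_div_iff₀ (sub_pos.2 h)] at this
    linarith

theorem localPoly_add_smul {d b : ℕ} (x₀ : Fin d → ℝ) (h : ℝ) (θ v : multiIdx d b → ℝ) (τ : ℝ)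
    (x : Fin d → ℝ) :
    localPoly x₀ h (θ + τ • v) x = localPoly x₀ h θ x + τ * localPoly x₀ h v x := by
  by_cases hx : x ∈ nbhd x₀ h
  · simp only [localPoly_of_mem _ hx, polyVal, Finset.mul_sum, ← Finset.sum_add_distrib]
    exact Finset.sum_congr rfl fun p _ => by simp; ring
  · simp [localPoly, hx]

theorem add_smul_sub_mem_paramSet {d b : ℕ} {M : ℝ} {θ t : multiIdx d b → ℝ}
    (hθ : θ ∈ paramSet d b M) (ht : t ∈ paramSet d b M) {τ : ℝ} (h0 : 0 ≤ τ) (h1 : τ ≤ 1) :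
    θ + τ • (t - θ) ∈ paramSet d b M := by
  simp only [paramSet, Set.mem_ofPred_eq] at *
  calc ∑ p, |(θ + τ • (t - θ)) p| ≤ ∑ p, ((1 - τ) * |θ p| + τ * |t p|) := by
        refine Finset.sum_le_sum fun p _ => ?_
        have : (θ + τ • (t - θ)) p = (1 - τ) * θ p + τ * t p := by simp; ring
        rw [this]
        refine (abs_add_le _ _).trans ?_
        rw [abs_mul, abs_mul, abs_of_nonneg h0, abs_of_nonneg (sub_nonneg.2 h1)]
    _ = (1 - τ) * ∑ p, |θ p| + τ * ∑ p, |t p| := by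
        rw [Finset.sum_add_distrib, Finset.mul_sum, Finset.mul_sum]
    _ ≤ M := by nlinarith

/-- Between `θ` and the estimator, the score in the direction of the estimator is nonnegative. -/
theorem sum_scoreTerm_nonneg {d b n : ℕ} {ρ : ℝ → ℝ} {K : (Fin d → ℝ) → ℝ} {x₀ : Fin d → ℝ}
    {h M : ℝ} {f : (Fin d → ℝ) → ℝ} (hK : IsKernel K) (hρ : IsContrast ρ)
    (hw : WindowInCube K x₀ h) (hh : 0 < h) (hn : 0 < n) {x : Fin n → Fin d → ℝ} {e : Fin n → ℝ}
    {θ t : multiIdx d b → ℝ} (hθ : θ ∈ paramSet d b M)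
    (ht : IsLocalMEstimate ρ K M x₀ h x (fun i => f (x i) + e i) t)
    {τ : ℝ} (h0 : 0 ≤ τ) (h1 : τ ≤ 1) :
    0 ≤ ∑ i, ∑ p, (τ • (t - θ)) p *
      scoreTerm ρ K x₀ h f (θ + τ • (t - θ)) p (x i, e i) := by
  set w : Fin n → ℝ := fun i => localPoly x₀ h (t - θ) (x i) with hwdef
  -- Up to normalisation, `G σ` is minus the derivative of the criterion along the segment. The
  -- tangent inequality at `σ`, evaluated at the minimizer `1`, gives `(1 - σ) G σ ≥ 0`.
  set G : ℝ → ℝ := fun σ => ∑ i, deriv ρ (f (x i) + e i - (localPoly x₀ h θ (x i) + σ * w i)) *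
    w i * K (rescale x₀ h (x i)) with hG
  have hGcont : Continuous G := by
    have hc : Continuous (deriv ρ) := hρ.deriv_lipschitz.continuous
    fun_prop
  have hGnn : ∀ σ ∈ Set.Ico (0 : ℝ) 1, 0 ≤ G σ := by
    intro σ hσ
    have hmin := ht.2 _ (add_smul_sub_mem_paramSet hθ ht.1 hσ.1 hσ.2.le)
    have hone : localPoly x₀ h t = localPoly x₀ h (θ + (1 : ℝ) • (t - θ)) := by simp
    have hpos : 0 < 1 / ((n : ℝ) * h ^ d) := by positivity
    rw [criterion, criterion, mul_le_mul_iff_right₀ hpos, hone] at hmin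
    simp only [localPoly_add_smul] at hmin
    have hgrad := Finset.sum_le_sum fun i (_ : i ∈ Finset.univ) =>
      mul_le_mul_of_nonneg_right (hρ.convex.add_deriv_mul_sub_le hρ.differentiable
        (f (x i) + e i - (localPoly x₀ h θ (x i) + 1 * w i))
        (f (x i) + e i - (localPoly x₀ h θ (x i) + σ * w i))) (hK.nonneg (rescale x₀ h (x i)))
    have hcomb := hgrad.trans hmin
    simp only [add_mul, Finset.sum_add_distrib] at hcomb
    have hlin : ∑ i, deriv ρ (f (x i) + e i - (localPoly x₀ h θ (x i) + σ * w i)) *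
        (f (x i) + e i - (localPoly x₀ h θ (x i) + 1 * w i) -
          (f (x i) + e i - (localPoly x₀ h θ (x i) + σ * w i))) * K (rescale x₀ h (x i)) =
        -((1 - σ) * G σ) := by
      rw [hG, Finset.mul_sum, ← Finset.sum_neg_distrib]
      exact Finset.sum_congr rfl fun i _ => by ring
    rw [hlin] at hcomb
    have hle : 0 ≤ (1 - σ) * G σ := by
      have : (∑ i, ρ (f (x i) + e i - (localPoly x₀ h θ (x i) + σ * w i)) *
          K (rescale x₀ h (x i))) + -((1 - σ) * G σ) ≤
          ∑ i, ρ (f (x i) + e i - (localPoly x₀ h θ (x i) + σ * w i)) *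
          K (rescale x₀ h (x i)) := hcomb
      linarith
    exact nonneg_of_mul_nonneg_right hle (by linarith [hσ.2])
  -- The previous argument is void at `σ = 1`; continuity of `ρ'` recovers that endpoint, which
  -- occurs when the estimator lies on the sphere itself.
  have hGτ : 0 ≤ G τ := by
    have hcl : τ ∈ closure (Set.Ico (0 : ℝ) 1) := by
      rw [closure_Ico zero_ne_one]
      exact ⟨h0, h1⟩
    exact (isClosed_Ici.preimage hGcont).closure_subset_iff.2 hGnn hcl
  have hsum : ∑ i, ∑ p, (τ • (t - θ)) p *
      scoreTerm ρ K x₀ h f (θ + τ • (t - θ)) p (x i, e i) = τ * G τ := by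
    rw [hG, Finset.mul_sum]
    refine Finset.sum_congr rfl fun i _ => ?_
    rw [sum_mul_scoreTerm]
    by_cases hz : K (rescale x₀ h (x i)) = 0
    · simp [hz]
    · have hx := hw.mem_nbhd hK hh hz
      have hq : polyVal (τ • (t - θ)) (rescale x₀ h (x i)) = τ * w i := by
        rw [hwdef]
        simp only [localPoly_of_mem _ hx, polyVal, Finset.mul_sum]
        exact Finset.sum_congr rfl fun p _ => by simp; ring
      rw [hq, localPoly_add_smul]
      ring
  rw [hsum]
  exact mul_nonneg h0 hGτ

/-! ### Finite nets of the unit sphere -/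

/-- Compactness suffices, with no bound on the cardinality: the net is fixed before `δ` is chosen.
-/
theorem exists_finset_sphere_net (ι : Type*) [Fintype ι] {η : ℝ} (hη : 0 < η) :
    ∃ F : Finset (ι → ℝ), (∀ u ∈ F, ∑ p, u p ^ 2 = 1) ∧
      ∀ u : ι → ℝ, ∑ p, u p ^ 2 = 1 → ∃ v ∈ F, ∑ p, |u p - v p| ≤ η := by
  set S : Set (ι → ℝ) := {u | ∑ p, u p ^ 2 = 1} with hS
  have hcpt : IsCompact S := by
    refine Metric.isCompact_of_isClosed_isBounded ?_ ?_
    · exact isClosed_eq (by fun_prop) continuous_const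
    · refine (Metric.isBounded_closedBall (x := (0 : ι → ℝ)) (r := 1)).subset fun u hu => ?_
      rw [mem_closedBall_zero_iff, pi_norm_le_iff_of_nonneg zero_le_one]
      intro p
      have : u p ^ 2 ≤ 1 :=
        (Finset.single_le_sum (f := fun p => u p ^ 2) (fun _ _ => sq_nonneg _)
          (Finset.mem_univ p)).trans_eq hu
      rw [Real.norm_eq_abs]
      exact (sq_le_one_iff_abs_le_one _).1 this
  obtain ⟨F, hFS, hFfin, hcov⟩ := finite_cover_balls_of_compact hcpt
    (e := η / (Fintype.card ι + 1)) (by positivity)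
  refine ⟨hFfin.toFinset, fun u hu => hFS (hFfin.mem_toFinset.1 hu), fun u hu => ?_⟩
  obtain ⟨v, hv, huv⟩ := Set.mem_iUnion₂.1 (hcov hu)
  refine ⟨v, hFfin.mem_toFinset.2 hv, ?_⟩
  calc ∑ p, |u p - v p| ≤ ∑ _p : ι, η / (Fintype.card ι + 1) := by
        refine Finset.sum_le_sum fun p _ => ?_
        rw [← Real.dist_eq]
        exact (dist_le_pi_dist u v p).trans (Metric.mem_ball.1 huv).le
    _ = Fintype.card ι * (η / (Fintype.card ι + 1)) := by simp
    _ ≤ η := by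
        rw [mul_div_assoc', div_le_iff₀ (by positivity)]
        nlinarith

/-! ### The constant `Σ` -/

/-- A divergent `tsum` would be `0`, so bounding `Σ` from below requires convergence. With `y` of
order `10^l / l^4`, the bound `exp(-y) ≤ 6/y³` beats `10^(2l)` and leaves `l^12 10^(-l)`. -/
theorem summable_sigmaConst (d : ℕ) {κ : ℝ} (hκ : 0 < κ) :
    Summable fun k : ℕ => (d : ℝ) ^ 2 * 10 ^ (2 * (k + 1) - 1) *
      Real.exp (-((18 * 10 ^ (k + 1)) / (Real.pi ^ 4 * ((k : ℝ) + 1) ^ 4) *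
        ((8 * κ)⁻¹ / (κ + 1 / 3)))) := by
  set A : ℝ := 18 / Real.pi ^ 4 * ((8 * κ)⁻¹ / (κ + 1 / 3)) with hA
  have hA0 : 0 < A := by positivity
  have hsum : Summable fun k : ℕ => (d : ℝ) ^ 2 * (6 / A ^ 3) *
      (((k + 1 : ℕ) : ℝ) ^ 12 * (1 / 10) ^ (k + 1)) := by
    refine Summable.mul_left _ ?_
    have := summable_pow_mul_geometric_of_norm_lt_one 12 (r := (1 / 10 : ℝ)) (by norm_num)
    exact (summable_nat_add_iff 1).2 this
  refine hsum.of_nonneg_of_le (fun k => by positivity) fun k => ?_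
  set l : ℝ := (k : ℝ) + 1 with hl
  have hl0 : 0 < l := by positivity
  set y : ℝ := A * (10 ^ (k + 1) / l ^ 4) with hy
  have hy0 : 0 < y := by positivity
  have hexp : Real.exp (-y) ≤ 6 / y ^ 3 := by
    have h3 := Real.pow_div_factorial_le_exp y hy0.le 3
    rw [Real.exp_neg, inv_le_comm₀ (Real.exp_pos _) (by positivity), inv_div]
    simpa [Nat.factorial] using h3
  have hrw : (18 * 10 ^ (k + 1)) / (Real.pi ^ 4 * l ^ 4) * ((8 * κ)⁻¹ / (κ + 1 / 3)) = y := by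
    rw [hy, hA]
    field_simp
  rw [hrw]
  have hpow : (10 : ℝ) ^ (2 * (k + 1) - 1) ≤ (10 ^ (k + 1)) ^ 2 := by
    rw [← pow_mul, mul_comm]
    exact pow_le_pow_right₀ (by norm_num) (by omega)
  calc (d : ℝ) ^ 2 * 10 ^ (2 * (k + 1) - 1) * Real.exp (-y)
      ≤ (d : ℝ) ^ 2 * (10 ^ (k + 1)) ^ 2 * (6 / y ^ 3) := by gcongr
    _ = _ := by
        rw [hy, one_div, inv_pow]
        push_cast
        rw [← hl]
        field_simp

/-- The term `l = 1` alone is enough: its exponent is at least `-1`, so it is at least `10/5 = 2`,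
and `2 + 2 · 2 = 6`. -/
theorem six_le_sigmaConst {d : ℕ} (hd : 0 < d) {κ : ℝ} (hκ : 1 ≤ κ) : 6 ≤ sigmaConst d κ := by
  have hκ0 : 0 < κ := by linarith
  have hle := (summable_sigmaConst d hκ0).le_tsum 0 fun k _ => by positivity
  rw [sigmaConst]
  refine le_trans ?_ (add_le_add_right (mul_le_mul_of_nonneg_left hle zero_le_two) 2)
  have hd1 : (1 : ℝ) ≤ (d : ℝ) ^ 2 := one_le_pow₀ (by exact_mod_cast hd)
  have hpi : (81 : ℝ) ≤ Real.pi ^ 4 := by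
    calc (81 : ℝ) = 3 ^ 4 := by norm_num
      _ ≤ Real.pi ^ 4 := by gcongr; exact Real.pi_gt_three.le
  have hfrac : (8 * κ)⁻¹ / (κ + 1 / 3) ≤ 1 / 8 := by
    rw [div_le_iff₀ (by positivity), inv_le_iff_one_le_mul₀ (by positivity)]
    nlinarith
  have hexp : (18 * 10 ^ (0 + 1)) / (Real.pi ^ 4 * (((0 : ℕ) : ℝ) + 1) ^ 4) *
      ((8 * κ)⁻¹ / (κ + 1 / 3)) ≤ 1 := by
    calc _ ≤ (18 * 10 ^ (0 + 1)) / (81 * (((0 : ℕ) : ℝ) + 1) ^ 4) * (1 / 8) := by gcongr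
      _ ≤ 1 := by norm_num
  have hE : (1 : ℝ) / 5 ≤ Real.exp (-((18 * 10 ^ (0 + 1)) / (Real.pi ^ 4 *
      (((0 : ℕ) : ℝ) + 1) ^ 4) * ((8 * κ)⁻¹ / (κ + 1 / 3)))) := by
    calc (1 : ℝ) / 5 ≤ Real.exp (-1) := by
          rw [Real.exp_neg, one_div]
          exact inv_anti₀ (Real.exp_pos _) (by linarith [Real.exp_one_lt_d9])
      _ ≤ _ := Real.exp_le_exp.2 (neg_le_neg hexp)
  have : (2 : ℝ) ≤ (d : ℝ) ^ 2 * 10 ^ (2 * (0 + 1) - 1) * Real.exp (-((18 * 10 ^ (0 + 1)) /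
      (Real.pi ^ 4 * (((0 : ℕ) : ℝ) + 1) ^ 4) * ((8 * κ)⁻¹ / (κ + 1 / 3)))) := by
    calc (2 : ℝ) = 1 * 10 ^ (2 * (0 + 1) - 1) * (1 / 5) := by norm_num
      _ ≤ _ := by gcongr
  linarith

/-! ### Deviations of sums over the sample -/

/-- The centred sum of `Φ (X i, ξ i)` over the sample. -/
def deviation {Ω : Type*} [MeasurableSpace Ω] (P : Measure Ω) {d n : ℕ}
    (X : Fin n → Ω → Fin d → ℝ) (ξ : Fin n → Ω → ℝ) (Φ : (Fin d → ℝ) × ℝ → ℝ) (ω : Ω) : ℝ :=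
  ∑ i, Φ (X i ω, ξ i ω) - ∑ i, ∫ ω', Φ (X i ω', ξ i ω') ∂P

/-- Bernstein with range `Aκ` and variance `A²κm`, where `κ = sup K`. It serves with `A = 1` for the
kernel mass, `A = 1 ∨ sup|ρ'|` for the score at `θ`, and `A = Nr` for increments of the score. -/
theorem measureReal_deviation_ge_le {Ω : Type*} [MeasurableSpace Ω] {P : Measure Ω}
    [IsProbabilityMeasure P] {d n : ℕ} {g : Fin n → ℝ → ℝ} {X : Fin n → Ω → Fin d → ℝ}
    {ξ : Fin n → Ω → ℝ} (hD : IsDesignNoise P g X ξ) {K : (Fin d → ℝ) → ℝ} {x₀ : Fin d → ℝ}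
    {h : ℝ} (hK : IsKernel K) (hw : WindowInCube K x₀ h) (hh : 0 < h) (hn : 0 < n)
    {Φ : (Fin d → ℝ) × ℝ → ℝ} (hΦ : Measurable Φ) {A : ℝ} (hA : 0 < A)
    (hΦA : ∀ y, |Φ y| ≤ A * K (rescale x₀ h y.1)) {u : ℝ} (hu : 0 ≤ u) :
    P.real {ω | √(n * h ^ d) * u ≤ |deviation P X ξ Φ ω|} ≤
      2 * Real.exp (-(u ^ 2 / (2 * (A ^ 2 * supNorm K +
        2 * A * supNorm K * u / (3 * √(n * h ^ d)))))) := by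
  have hκ : 0 < supNorm K := zero_lt_one.trans_le hK.one_le_supNorm
  set m : ℝ := n * h ^ d with hm
  have hm0 : 0 < m := by positivity
  have hs0 : 0 < √m := Real.sqrt_pos.2 hm0
  have hsq : √m * √m = m := Real.mul_self_sqrt hm0.le
  have hind := (iIndepFun_prodMk hD.measurable_design hD.measurable_noise hD.indep_design
    hD.indep_noise hD.indep).comp (fun _ => Φ) fun _ => hΦ
  have hb := bernstein_abs_ge (Y := fun i ω => Φ (X i ω, ξ i ω)) (P := P)
    (B := A * supNorm K) (V := A ^ 2 * supNorm K * m) (t := √m * u) hind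
    (fun i => hΦ.comp ((hD.measurable_design i).prodMk (hD.measurable_noise i)))
    (fun i ω => (hΦA _).trans (mul_le_mul_of_nonneg_left (hK.le_supNorm _) hA.le))
    (by positivity) (by positivity) ?_ (by positivity)
  · refine hb.trans (le_of_eq ?_)
    congr 3
    have hpos : 0 < A ^ 2 * supNorm K + 2 * A * supNorm K * u / (3 * √m) := by positivity
    have hden : 2 * (A ^ 2 * supNorm K * m + 2 * (A * supNorm K) * (√m * u) / 3) =
        m * (2 * (A ^ 2 * supNorm K + 2 * A * supNorm K * u / (3 * √m))) := by
      field_simp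
      linear_combination (2 * u) * hsq
    rw [hden, mul_pow, Real.sq_sqrt hm0.le, mul_div_mul_left _ _ hm0.ne']
  · calc ∑ i, ∫ ω, Φ (X i ω, ξ i ω) ^ 2 ∂P ≤ ∑ _i : Fin n, A ^ 2 * supNorm K * h ^ d :=
          Finset.sum_le_sum fun i _ => integral_sq_le_of_abs_le hK hw hh
            (hD.measurable_design i) (hD.law_design i) fun ω => hΦA _
      _ = A ^ 2 * supNorm K * m := by simp [hm]; ring

theorem deviation_sub {Ω : Type*} [MeasurableSpace Ω] {P : Measure Ω} {d n : ℕ}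
    {X : Fin n → Ω → Fin d → ℝ} {ξ : Fin n → Ω → ℝ} {Φ Ψ : (Fin d → ℝ) × ℝ → ℝ}
    (hΦ : ∀ i, Integrable (fun ω => Φ (X i ω, ξ i ω)) P)
    (hΨ : ∀ i, Integrable (fun ω => Ψ (X i ω, ξ i ω)) P) (ω : Ω) :
    deviation P X ξ (fun y => Φ y - Ψ y) ω = deviation P X ξ Φ ω - deviation P X ξ Ψ ω := by
  simp only [deviation, integral_sub (hΦ _) (hΨ _), Finset.sum_sub_distrib]
  ring

section

variable {Ω : Type*} [MeasurableSpace Ω] {P : Measure Ω} [IsProbabilityMeasure P] {d n : ℕ}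
  {g : Fin n → ℝ → ℝ} {X : Fin n → Ω → Fin d → ℝ} {ξ : Fin n → Ω → ℝ}
  {K : (Fin d → ℝ) → ℝ} {x₀ : Fin d → ℝ} {h : ℝ}

theorem integrable_sample (hD : IsDesignNoise P g X ξ) (hK : IsKernel K)
    {Φ : (Fin d → ℝ) × ℝ → ℝ} (hΦ : Measurable Φ) {A : ℝ} (hA : 0 ≤ A)
    (hΦA : ∀ y, |Φ y| ≤ A * K (rescale x₀ h y.1)) (i : Fin n) :
    Integrable (fun ω => Φ (X i ω, ξ i ω)) P :=
  Integrable.of_bound (hΦ.comp ((hD.measurable_design i).prodMk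
    (hD.measurable_noise i))).aestronglyMeasurable (A * supNorm K)
    (ae_of_all _ fun _ => (hΦA _).trans (mul_le_mul_of_nonneg_left (hK.le_supNorm _) hA))

/-- Both the sum and its mean are dominated by kernel sums, whose mean is `n h^d`. The bound is
pointwise in `ω`, so it applies to a direction that depends on the sample. -/
theorem abs_deviation_le (hD : IsDesignNoise P g X ξ) (hK : IsKernel K)
    (hw : WindowInCube K x₀ h) (hh : 0 < h) {Φ : (Fin d → ℝ) × ℝ → ℝ} {A : ℝ}
    (hΦA : ∀ y, |Φ y| ≤ A * K (rescale x₀ h y.1)) (ω : Ω) :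
    |deviation P X ξ Φ ω| ≤
      A * (deviation P X ξ (fun y => K (rescale x₀ h y.1)) ω + 2 * (n * h ^ d)) := by
  have hmean : ∑ i, ∫ ω', K (rescale x₀ h (X i ω')) ∂P = n * h ^ d := by
    simp [integral_kernel_design hK hw hh (hD.measurable_design _) (hD.law_design _)]
  have hiK : ∀ i, Integrable (fun ω => K (rescale x₀ h (X i ω))) P := fun i =>
    integrable_sample hD hK (Φ := fun y => K (rescale x₀ h y.1))
      (hK.measurable.comp ((measurable_rescale x₀ h).comp measurable_fst)) zero_le_one
      (fun y => by rw [one_mul, abs_of_nonneg (hK.nonneg _)]) i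
  have h1 : |∑ i, Φ (X i ω, ξ i ω)| ≤ A * ∑ i, K (rescale x₀ h (X i ω)) := by
    rw [Finset.mul_sum]
    exact (Finset.abs_sum_le_sum_abs _ _).trans (Finset.sum_le_sum fun i _ => hΦA _)
  have h2 : |∑ i, ∫ ω', Φ (X i ω', ξ i ω') ∂P| ≤ A * (n * h ^ d) := by
    rw [← hmean, Finset.mul_sum]
    refine (Finset.abs_sum_le_sum_abs _ _).trans (Finset.sum_le_sum fun i _ => ?_)
    rw [← integral_const_mul]
    exact norm_integral_le_of_norm_le (f := fun ω' => Φ (X i ω', ξ i ω')) ((hiK i).const_mul A)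
      (ae_of_all _ fun ω' => hΦA _)
  calc |deviation P X ξ Φ ω|
      ≤ |∑ i, Φ (X i ω, ξ i ω)| + |∑ i, ∫ ω', Φ (X i ω', ξ i ω') ∂P| := abs_sub _ _
    _ ≤ A * ∑ i, K (rescale x₀ h (X i ω)) + A * (n * h ^ d) := add_le_add h1 h2
    _ = _ := by
        rw [deviation]
        simp only [hmean]
        ring

theorem abs_le_one_of_sum_sq {ι : Type*} [Fintype ι] {u : ι → ℝ} (hu : ∑ p, u p ^ 2 = 1)
    (p : ι) : |u p| ≤ 1 := by
  refine (sq_le_one_iff_abs_le_one _).1 ?_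
  exact (Finset.single_le_sum (f := fun p => u p ^ 2) (fun _ _ => sq_nonneg _)
    (Finset.mem_univ p)).trans_eq hu

theorem sum_abs_le_numIdx {b : ℕ} {u : multiIdx d b → ℝ} (hu : ∑ p, u p ^ 2 = 1) :
    ∑ p, |u p| ≤ numIdx d b := by
  calc ∑ p, |u p| ≤ ∑ _p : multiIdx d b, (1 : ℝ) :=
        Finset.sum_le_sum fun p _ => abs_le_one_of_sum_sq hu p
    _ = numIdx d b := by simp [numIdx]

theorem one_le_numIdx (d b : ℕ) : (1 : ℝ) ≤ numIdx d b := by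
  have : 0 < numIdx d b := Finset.card_pos.2 ⟨_, (zeroIdx d b).2⟩
  exact_mod_cast this

theorem measurable_sub_scoreTerm {b : ℕ} {ρ : ℝ → ℝ} {f : (Fin d → ℝ) → ℝ} (hK : IsKernel K)
    (hf : Measurable f) (s t : multiIdx d b → ℝ) (p : multiIdx d b) :
    Measurable fun y => scoreTerm ρ K x₀ h f s p y - scoreTerm ρ K x₀ h f t p y :=
  (measurable_scoreTerm hK hf s p).sub (measurable_scoreTerm hK hf t p)

/-- If the estimator is at distance at least `r` from `θ`, then some component of the score has a
large deviation on the sphere of radius `r` around `θ`. -/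
theorem exists_le_abs_deviation {b : ℕ} {ρ : ℝ → ℝ} {f : (Fin d → ℝ) → ℝ} {M : ℝ}
    (hD : IsDesignNoise P g X ξ) (hK : IsKernel K) (hρ : IsContrast ρ)
    (hw : WindowInCube K x₀ h) (hh : 0 < h) (hn : 0 < n) (hf : Measurable f)
    (hg : ∀ i, IsSymmMonotoneDensity (g i)) {L α c w₀ : ℝ} (hL : 0 < L) (hα : 0 < α)
    (hc0 : 0 < c) (hHol : SecondDerivHolder ρ L α g)
    (hc : ∀ i, c ≤ ∫ z, deriv (deriv ρ) z * g i z) (hw₀ : L * w₀ ^ α ≤ c / 2)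
    {θ t : multiIdx d b → ℝ} {β r : ℝ} (hβ0 : 0 ≤ β)
    (hβ : ∀ x ∈ nbhd x₀ h, |f x - localPoly x₀ h θ x| ≤ β) (hθ : θ ∈ paramSet d b M) {ω : Ω}
    (ht : IsLocalMEstimate ρ K M x₀ h (fun i => X i ω) (fun i => f (X i ω) + ξ i ω) t)
    (hr : 0 < r) (hrt : r ≤ √(∑ p, (t p - θ p) ^ 2)) (hrw : numIdx d b * r ≤ w₀) :
    ∃ u : multiIdx d b → ℝ, ∑ p, u p ^ 2 = 1 ∧ ∃ p,
      n * h ^ d * (c * minEigen b K / (2 * numIdx d b) * r - β) ≤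
        |deviation P X ξ (scoreTerm ρ K x₀ h f (θ + r • u) p) ω| := by
  set T := √(∑ p, (t p - θ p) ^ 2) with hT
  have hT0 : 0 < T := hr.trans_le hrt
  have hTsq : T ^ 2 = ∑ p, (t p - θ p) ^ 2 :=
    Real.sq_sqrt (Finset.sum_nonneg fun _ _ => sq_nonneg _)
  set u : multiIdx d b → ℝ := T⁻¹ • (t - θ) with hu
  have husq : ∑ p, u p ^ 2 = 1 := by
    simp only [hu, Pi.smul_apply, Pi.sub_apply, smul_eq_mul, mul_pow, ← Finset.mul_sum, ← hTsq]
    field_simp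
  refine ⟨u, husq, ?_⟩
  by_contra! hcon
  set N : ℝ := (numIdx d b : ℝ) with hN
  have hN1 : 1 ≤ N := one_le_numIdx d b
  have hlam := minEigen_pos b hK
  set m : ℝ := n * h ^ d with hm
  have hm0 : 0 < m := by positivity
  set s : multiIdx d b → ℝ := r • u with hs
  have hsτ : s = (r / T) • (t - θ) := by rw [hs, hu, smul_smul, div_eq_mul_inv]
  set S := ∑ p, |s p| with hS
  have hSle : S ≤ N * r := by
    have : S = r * ∑ p, |u p| := by
      simp [hS, hs, abs_mul, abs_of_pos hr, Finset.mul_sum]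
    rw [this, mul_comm N]
    exact mul_le_mul_of_nonneg_left (sum_abs_le_numIdx husq) hr.le
  have hssq : ∑ p, s p ^ 2 = r ^ 2 := by
    simp only [hs, Pi.smul_apply, smul_eq_mul, mul_pow, ← Finset.mul_sum, husq, mul_one]
  -- A nonzero coordinate of `s` is what makes the inequality in `hdev` strict.
  have hS0 : 0 < S := by
    refine lt_of_le_of_ne (Finset.sum_nonneg fun _ _ => abs_nonneg _) fun h0 => ?_
    have hz := (Finset.sum_eq_zero_iff_of_nonneg fun _ _ => abs_nonneg _).1 h0.symm
    have : ∑ p, s p ^ 2 = 0 := Finset.sum_eq_zero fun p hp => by simpa using hz p hp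
    rw [hssq] at this
    exact (pow_pos hr 2).ne' this
  have hnn := sum_scoreTerm_nonneg (f := f) (e := fun i => ξ i ω) hK hρ hw hh hn hθ ht
    (div_nonneg hr.le hT0.le) ((div_le_one hT0).2 hrt)
  rw [← hsτ] at hnn
  have hR0 : 0 ≤ supNorm (deriv ρ) := (abs_nonneg _).trans (hρ.abs_deriv_le 0)
  have hint : ∀ i p, Integrable (fun ω => scoreTerm ρ K x₀ h f (θ + s) p (X i ω, ξ i ω)) P :=
    fun i p => integrable_sample hD hK (measurable_scoreTerm hK hf _ p) hR0
      (abs_scoreTerm_le hK hρ _ p) i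
  have hmean : ∀ i, ∑ p, s p * ∫ ω', scoreTerm ρ K x₀ h f (θ + s) p (X i ω', ξ i ω') ∂P ≤
      h ^ d * (β * S - c / 2 * (minEigen b K * r ^ 2)) := by
    intro i
    have := integral_sum_mul_scoreTerm_le hK hρ hw hh hf (hg i) (hD.measurable_design i)
      (hD.law_design i) (hD.measurable_noise i) (hD.law_noise i)
      (hD.indep.comp (measurable_pi_apply i) (measurable_pi_apply i)) hL hα hc0 (hHol i) (hc i)
      hw₀ hβ0 hβ (hSle.trans hrw)
    rw [integral_finsetSum _ fun p _ => (hint i p).const_mul _] at this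
    simp_rw [integral_const_mul] at this
    rwa [hssq] at this
  have hdecomp : ∑ i, ∑ p, s p * scoreTerm ρ K x₀ h f (θ + s) p (X i ω, ξ i ω) =
      ∑ p, s p * deviation P X ξ (scoreTerm ρ K x₀ h f (θ + s) p) ω +
        ∑ i, ∑ p, s p * ∫ ω', scoreTerm ρ K x₀ h f (θ + s) p (X i ω', ξ i ω') ∂P := by
    simp only [deviation, mul_sub, Finset.sum_sub_distrib, Finset.mul_sum]
    rw [Finset.sum_comm (γ := Fin n), Finset.sum_comm (γ := Fin n) (f := fun i p =>
      s p * ∫ ω', scoreTerm ρ K x₀ h f (θ + s) p (X i ω', ξ i ω') ∂P)]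
    ring
  have hdev : ∑ p, s p * deviation P X ξ (scoreTerm ρ K x₀ h f (θ + s) p) ω <
      S * (m * (c * minEigen b K / (2 * N) * r - β)) := by
    rw [hS, Finset.sum_mul]
    have hle : ∀ p, s p * deviation P X ξ (scoreTerm ρ K x₀ h f (θ + s) p) ω ≤
        |s p| * |deviation P X ξ (scoreTerm ρ K x₀ h f (θ + s) p) ω| := fun p => by
      rw [← abs_mul]; exact le_abs_self _
    obtain ⟨p, -, hp⟩ := Finset.exists_ne_zero_of_sum_ne_zero hS0.ne'
    refine Finset.sum_lt_sum (fun p _ => (hle p).trans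
      (mul_le_mul_of_nonneg_left (hcon p).le (abs_nonneg _))) ⟨p, Finset.mem_univ p, ?_⟩
    exact (hle p).trans_lt (mul_lt_mul_of_pos_left (hcon p)
      (lt_of_le_of_ne (abs_nonneg _) hp.symm))
  have hmean' : ∑ i, ∑ p, s p * ∫ ω', scoreTerm ρ K x₀ h f (θ + s) p (X i ω', ξ i ω') ∂P ≤
      m * (β * S - c / 2 * (minEigen b K * r ^ 2)) := by
    calc _ ≤ ∑ _i : Fin n, h ^ d * (β * S - c / 2 * (minEigen b K * r ^ 2)) :=
          Finset.sum_le_sum fun i _ => hmean i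
      _ = _ := by simp [hm]; ring
  -- The bias terms cancel, and the sign left is that of `S - N r`; this is why the threshold
  -- carries `2N` in its denominator.
  have hfin : S * (m * (c * minEigen b K / (2 * N) * r - β)) +
      m * (β * S - c / 2 * (minEigen b K * r ^ 2)) =
      m * (c * minEigen b K * r / (2 * N)) * (S - N * r) := by
    field_simp
    ring
  have hneg : m * (c * minEigen b K * r / (2 * N)) * (S - N * r) ≤ 0 :=
    mul_nonpos_of_nonneg_of_nonpos (by positivity) (by linarith)
  linarith

end

/-! ### Comparison of exponents -/

section

variable {N κ R cl q a ε δ Q : ℝ}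

/-- With `x = cl ε/(2N)`, the two denominators differ only by `κ²` against `κ` and by `x` against `x
- a`, both in the favourable direction. -/
theorem exponent_le_center (hN : 1 ≤ N) (hκ : 1 ≤ κ) (hR : 1 ≤ R) (hcl : 0 < cl) (hq : 0 < q)
    (ha : 1 ≤ a) (hx : 2 * a ≤ cl / (2 * N) * ε) :
    (cl / (2 * N) * ε - a) ^ 2 /
        (8 * κ ^ 2 * R ^ 2 + 4 * κ / (3 * N) * R * (cl * ε / q)) ≤
      ((cl / (2 * N) * ε - a) / 2) ^ 2 / (2 * (R ^ 2 * κ +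
        2 * R * κ * ((cl / (2 * N) * ε - a) / 2) / (3 * q))) := by
  set x := cl / (2 * N) * ε with hxdef
  have hε : cl * ε = 2 * N * x := by rw [hxdef]; field_simp
  have hden : 4 * κ / (3 * N) * R * (cl * ε / q) = 8 * κ * R * x / (3 * q) := by
    rw [hε]; field_simp; ring
  have hxa : 0 ≤ x - a := by linarith
  have hrw : ((x - a) / 2) ^ 2 / (2 * (R ^ 2 * κ + 2 * R * κ * ((x - a) / 2) / (3 * q))) =
      (x - a) ^ 2 / (8 * R ^ 2 * κ + 8 * R * κ * (x - a) / (3 * q)) := by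
    rw [div_pow, div_div]
    congr 1
    ring
  rw [hden, hrw]
  refine div_le_div_of_nonneg_left (sq_nonneg _) (by positivity) ?_
  have h1 : 8 * R ^ 2 * κ ≤ 8 * κ ^ 2 * R ^ 2 := by
    have : κ ≤ κ ^ 2 := le_self_pow₀ hκ two_ne_zero
    nlinarith [sq_nonneg R]
  have h2 : 8 * R * κ * (x - a) / (3 * q) ≤ 8 * κ * R * x / (3 * q) := by
    gcongr ?_ / _
    have : 0 ≤ κ * R := by positivity
    nlinarith
  linarith

theorem exponent_le_sq (hN : 1 ≤ N) (hκ : 1 ≤ κ) (hR : 1 ≤ R) (hcl : 0 < cl) (hq : 0 < q)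
    (hε : 0 < ε) :
    (cl / (2 * N) * ε - a) ^ 2 /
        (8 * κ ^ 2 * R ^ 2 + 4 * κ / (3 * N) * R * (cl * ε / q)) ≤
      (cl / (2 * N) * ε - a) ^ 2 / 8 := by
  refine div_le_div_of_nonneg_left (sq_nonneg _) (by norm_num) ?_
  have h1 : 1 ≤ κ ^ 2 * R ^ 2 := one_le_mul_of_one_le_of_one_le (one_le_pow₀ hκ) (one_le_pow₀ hR)
  have h2 : 0 ≤ 4 * κ / (3 * N) * R * (cl * ε / q) := by positivity
  linarith

/-- The bound on `δ` forces `cl ε/(2N) ≤ q/κ`. The left side is then at most `q²/(8κ)`, while the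
right side equals `3q²/(10κ)`. -/
theorem exponent_le_kernel (hN : 1 ≤ N) (hκ : 1 ≤ κ) (hR : 1 ≤ R) (hcl : 0 < cl) (hq : 0 < q)
    (ha : 1 ≤ a) (hx : 2 * a ≤ cl / (2 * N) * ε) (hε : 0 < ε) (hεδ : ε ≤ q * δ)
    (hδ : δ ≤ 2 * N / (cl * κ)) :
    (cl / (2 * N) * ε - a) ^ 2 /
        (8 * κ ^ 2 * R ^ 2 + 4 * κ / (3 * N) * R * (cl * ε / q)) ≤
      q ^ 2 / (2 * (1 ^ 2 * κ + 2 * 1 * κ * q / (3 * q))) := by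
  refine (exponent_le_sq hN hκ hR hcl hq hε).trans ?_
  have hxq : cl / (2 * N) * ε ≤ q / κ := by
    calc cl / (2 * N) * ε ≤ cl / (2 * N) * (q * (2 * N / (cl * κ))) := by
          gcongr
          exact hεδ.trans (by gcongr)
      _ = q / κ := by field_simp
  have hsq : (cl / (2 * N) * ε - a) ^ 2 ≤ (q / κ) ^ 2 :=
    pow_le_pow_left₀ (by linarith) (by linarith) 2
  have hrw : q ^ 2 / (2 * (1 ^ 2 * κ + 2 * 1 * κ * q / (3 * q))) = 3 * q ^ 2 / (10 * κ) := by
    field_simp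
    ring
  rw [hrw]
  have h2 : (q / κ) ^ 2 ≤ q ^ 2 / κ := by
    rw [div_pow]
    exact div_le_div_of_nonneg_left (sq_nonneg _) (by positivity) (by nlinarith)
  have h3 : 3 * q ^ 2 / (10 * κ) = 3 / 10 * (q ^ 2 / κ) := by field_simp
  have h4 : 0 ≤ q ^ 2 / κ := by positivity
  rw [h3]
  linarith

/-- The range of an increment is proportional to `ε/q ≤ δ`, so with `y = cl ε/(2N) - a` its
Bernstein exponent is at least of order `y²/δ²`. Small `δ` lifts it above `y²(1 + Q)`, and `y ≥ 1`
leaves room for `Q`. -/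
theorem exponent_add_le_net (hN : 1 ≤ N) (hκ : 1 ≤ κ) (hR : 1 ≤ R) (hcl : 0 < cl) (hq : 0 < q)
    (ha : 1 ≤ a) (hx : 2 * a ≤ cl / (2 * N) * ε) (hε : 0 < ε) (hεδ : ε ≤ q * δ) (hQ : 0 ≤ Q)
    (hδ : 32 * κ * δ ^ 2 * (N ^ 2 + cl) * (1 + Q) ≤ 1) :
    (cl / (2 * N) * ε - a) ^ 2 /
        (8 * κ ^ 2 * R ^ 2 + 4 * κ / (3 * N) * R * (cl * ε / q)) + Q ≤
      ((cl / (2 * N) * ε - a) / 4) ^ 2 / (2 * ((N * (ε / q)) ^ 2 * κ +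
        2 * (N * (ε / q)) * κ * ((cl / (2 * N) * ε - a) / 4) / (3 * q))) := by
  have h8 := exponent_le_sq (a := a) hN hκ hR hcl hq hε
  set E := (cl / (2 * N) * ε - a) ^ 2 /
        (8 * κ ^ 2 * R ^ 2 + 4 * κ / (3 * N) * R * (cl * ε / q))
  set y := cl / (2 * N) * ε - a with hy
  have hy1 : 1 ≤ y := by linarith
  set r := ε / q with hr
  have hr0 : 0 < r := by positivity
  have hrδ : r ≤ δ := by rw [hr, div_le_iff₀ hq, mul_comm]; exact hεδ
  have hyq : y / q ≤ cl / (2 * N) * r := by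
    rw [hr, mul_div_assoc', div_le_div_iff_of_pos_right hq]
    linarith
  have hden : (N * r) ^ 2 * κ + 2 * (N * r) * κ * (y / 4) / (3 * q) ≤
      κ * δ ^ 2 * (N ^ 2 + cl) := by
    have e1 : 2 * (N * r) * κ * (y / 4) / (3 * q) = N * r * κ / 6 * (y / q) := by
      field_simp; ring
    have e2 : N * r * κ / 6 * (y / q) ≤ N * r * κ / 6 * (cl / (2 * N) * r) := by gcongr
    have e3 : N * r * κ / 6 * (cl / (2 * N) * r) = κ * r ^ 2 * (cl / 12) := by
      field_simp; ring
    have e4 : κ * r ^ 2 * (N ^ 2 + cl) ≤ κ * δ ^ 2 * (N ^ 2 + cl) := by gcongr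
    have e5 : 0 ≤ κ * r ^ 2 * cl := by positivity
    rw [e1]
    nlinarith
  have hpos : 0 < (N * r) ^ 2 * κ + 2 * (N * r) * κ * (y / 4) / (3 * q) := by positivity
  have hlow : y ^ 2 * (1 + Q) ≤ (y / 4) ^ 2 / (2 * ((N * r) ^ 2 * κ +
      2 * (N * r) * κ * (y / 4) / (3 * q))) := by
    rw [le_div_iff₀ (by positivity)]
    calc y ^ 2 * (1 + Q) * (2 * ((N * r) ^ 2 * κ + 2 * (N * r) * κ * (y / 4) / (3 * q)))
        ≤ y ^ 2 * (1 + Q) * (2 * (κ * δ ^ 2 * (N ^ 2 + cl))) := by gcongr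
      _ = y ^ 2 / 16 * (32 * κ * δ ^ 2 * (N ^ 2 + cl) * (1 + Q)) := by ring
      _ ≤ y ^ 2 / 16 * 1 := by gcongr
      _ = (y / 4) ^ 2 := by ring
  have hQy : Q ≤ y ^ 2 * Q := le_mul_of_one_le_left hQ (one_le_pow₀ hy1)
  nlinarith [sq_nonneg y]

end

/-! ### Discretisation of the sphere and the union bound -/

section

variable {Ω : Type*} [MeasurableSpace Ω] {P : Measure Ω} [IsProbabilityMeasure P] {d n b : ℕ}
  {g : Fin n → ℝ → ℝ} {X : Fin n → Ω → Fin d → ℝ} {ξ : Fin n → Ω → ℝ}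
  {K : (Fin d → ℝ) → ℝ} {x₀ : Fin d → ℝ} {h : ℝ} {ρ : ℝ → ℝ} {f : (Fin d → ℝ) → ℝ}

/-- A large deviation of the score on the sphere of radius `r` around `θ` comes from the design,
from the centre `θ` or from a point of a finite net of the sphere. -/
theorem exists_deviation_net (hD : IsDesignNoise P g X ξ) (hK : IsKernel K) (hρ : IsContrast ρ)
    (hw : WindowInCube K x₀ h) (hh : 0 < h) (hn : 0 < n) (hf : Measurable f)
    {F : Finset (multiIdx d b → ℝ)} {η r y : ℝ} (hr : 0 < r) {θ u : multiIdx d b → ℝ}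
    (hF : ∃ v ∈ F, ∑ p, |u p - v p| ≤ η)
    (hη : 3 * (r * η) * √(n * h ^ d) ≤ y / 4) {p : multiIdx d b} {ω : Ω}
    (hdev : √(n * h ^ d) * y ≤ |deviation P X ξ (scoreTerm ρ K x₀ h f (θ + r • u) p) ω|) :
    √(n * h ^ d) * √(n * h ^ d) ≤ |deviation P X ξ (fun y => K (rescale x₀ h y.1)) ω| ∨
      √(n * h ^ d) * (y / 2) ≤ |deviation P X ξ (scoreTerm ρ K x₀ h f θ p) ω| ∨
      ∃ v ∈ F, √(n * h ^ d) * (y / 4) ≤ |deviation P X ξ (fun y =>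
        scoreTerm ρ K x₀ h f (θ + r • v) p y - scoreTerm ρ K x₀ h f θ p y) ω| := by
  obtain ⟨v, hv, huv⟩ := hF
  by_contra! hcon
  obtain ⟨hker, hcen, hnet⟩ := hcon
  replace hnet := hnet v hv
  set m : ℝ := n * h ^ d with hm
  have hm0 : 0 < m := by positivity
  have hsq : √m * √m = m := Real.mul_self_sqrt hm0.le
  have hR0 : 0 ≤ supNorm (deriv ρ) := (abs_nonneg _).trans (hρ.abs_deriv_le 0)
  have hint : ∀ t i, Integrable (fun ω => scoreTerm ρ K x₀ h f t p (X i ω, ξ i ω)) P :=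
    fun t i => integrable_sample hD hK (measurable_scoreTerm hK hf _ p) hR0
      (abs_scoreTerm_le hK hρ _ p) i
  have hl1 : ∑ q, |(θ + r • u) q - (θ + r • v) q| = r * ∑ q, |u q - v q| := by
    rw [Finset.mul_sum]
    refine Finset.sum_congr rfl fun q _ => ?_
    rw [← abs_of_pos hr, ← abs_mul, abs_of_pos hr]
    congr 1
    simp
    ring
  have hosc := abs_deviation_le hD hK hw hh
    (fun y => abs_scoreTerm_sub_le (f := f) hK hρ hw hh (θ + r • u) (θ + r • v) p y) ω
  rw [deviation_sub (hint _) (hint _), hl1, ← hm] at hosc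
  rw [deviation_sub (hint _) (hint _)] at hnet
  -- Off the kernel event this deviation is below `m`; together with the `2m` in `hosc` it gives the
  -- factor `3m`, hence the `3` in `hη`.
  have hlt : deviation P X ξ (fun y => K (rescale x₀ h y.1)) ω < m :=
    (le_abs_self _).trans_lt (hker.trans_eq hsq)
  have hnn : 0 ≤ r * ∑ q, |u q - v q| :=
    mul_nonneg hr.le (Finset.sum_nonneg fun _ _ => abs_nonneg _)
  have hosc' : |deviation P X ξ (scoreTerm ρ K x₀ h f (θ + r • u) p) ω -
      deviation P X ξ (scoreTerm ρ K x₀ h f (θ + r • v) p) ω| ≤ √m * (y / 4) := by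
    calc _ ≤ r * (∑ q, |u q - v q|) *
          (deviation P X ξ (fun y => K (rescale x₀ h y.1)) ω + 2 * m) := hosc
      _ ≤ r * (∑ q, |u q - v q|) * (3 * m) := by
          refine mul_le_mul_of_nonneg_left ?_ hnn
          linarith
      _ ≤ r * η * (3 * m) := by gcongr
      _ = √m * (3 * (r * η) * √m) := by linear_combination (-3 * (r * η)) * hsq
      _ ≤ √m * (y / 4) := by gcongr
  have htri := abs_add_three
    (deviation P X ξ (scoreTerm ρ K x₀ h f (θ + r • u) p) ω -
      deviation P X ξ (scoreTerm ρ K x₀ h f (θ + r • v) p) ω)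
    (deviation P X ξ (scoreTerm ρ K x₀ h f (θ + r • v) p) ω -
      deviation P X ξ (scoreTerm ρ K x₀ h f θ p) ω)
    (deviation P X ξ (scoreTerm ρ K x₀ h f θ p) ω)
  rw [sub_add_sub_cancel, sub_add_cancel] at htri
  linarith

theorem taylorCoeff_zeroIdx (f : (Fin d → ℝ) → ℝ) (x₀ : Fin d → ℝ) (h : ℝ) :
    taylorCoeff f x₀ h (zeroIdx d b) = f x₀ := by
  have hdir : directions (0 : Fin d → ℕ) = [] := by simp [directions]
  simp [taylorCoeff, hdir, IterPartialExists, iterPartial, zeroIdx]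

theorem abs_sub_le_sqrt_sum {ι : Type*} [Fintype ι] (t θ : ι → ℝ) (p : ι) :
    |t p - θ p| ≤ √(∑ p, (t p - θ p) ^ 2) := by
  rw [← Real.sqrt_sq_eq_abs]
  exact Real.sqrt_le_sqrt (Finset.single_le_sum (f := fun p => (t p - θ p) ^ 2)
    (fun _ _ => sq_nonneg _) (Finset.mem_univ p))

/-- The deviation inequality for radii `δ` that are small in terms of the cardinality of a net of
the sphere. -/
theorem measureReal_le_deviationBound (hd : 0 < d) (hD : IsDesignNoise P g X ξ) (hK : IsKernel K)
    (hρ : IsContrast ρ) (hw : WindowInCube K x₀ h) (hh : 0 < h) (hn : 0 < n) (hf : Measurable f)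
    (hg : ∀ i, IsSymmMonotoneDensity (g i)) {L α c w₀ M : ℝ} (hL : 0 < L) (hα : 0 < α)
    (hc0 : 0 < c) (hHol : SecondDerivHolder ρ L α g)
    (hc : ∀ i, c ≤ ∫ z, deriv (deriv ρ) z * g i z) (hw₀ : L * w₀ ^ α ≤ c / 2)
    (hθ : taylorCoeff f x₀ h ∈ paramSet d b M) (hbias : BddAbove (biasValues b f x₀ h))
    {F : Finset (multiIdx d b → ℝ)} (hF1 : ∀ v ∈ F, ∑ p, v p ^ 2 = 1)
    (hF : ∀ u : multiIdx d b → ℝ, ∑ p, u p ^ 2 = 1 →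
      ∃ v ∈ F, ∑ p, |u p - v p| ≤ c * minEigen b K / (48 * numIdx d b))
    {δ : ℝ} (hδw : numIdx d b * δ ≤ w₀)
    (hδK : δ ≤ 2 * numIdx d b / (c * minEigen b K * supNorm K))
    (hδF : 32 * supNorm K * δ ^ 2 * ((numIdx d b : ℝ) ^ 2 + c * minEigen b K) * (1 + F.card) ≤ 1)
    {θhat : Ω → multiIdx d b → ℝ}
    (hθhat : ∀ ω, IsLocalMEstimate ρ K M x₀ h
      (fun i => X i ω) (fun i => f (X i ω) + ξ i ω) (θhat ω))
    {ε : ℝ} (hε : 4 * numIdx d b / (c * minEigen b K) *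
      max 1 (bias b f x₀ h * √(n * h ^ d)) ≤ ε) :
    P.real {ω | ε ≤ √(n * h ^ d) * |θhat ω (zeroIdx d b) - f x₀| ∧
        θhat ω ∈ paramBall M (taylorCoeff f x₀ h) δ} ≤
      deviationBound (numIdx d b) (sigmaConst d (supNorm K)) c (minEigen b K) (supNorm K)
        (supNorm (deriv ρ)) (n * h ^ d) (bias b f x₀ h) ε := by
  set N : ℝ := (numIdx d b : ℝ) with hNdef
  set κ := supNorm K with hκdef
  set R := max 1 (supNorm (deriv ρ)) with hRdef
  set cl := c * minEigen b K with hcldef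
  set m : ℝ := n * h ^ d with hm
  set β := bias b f x₀ h with hβdef
  set a := max 1 (β * √m) with hadef
  set θ : multiIdx d b → ℝ := taylorCoeff f x₀ h with hθdef
  have hN : 1 ≤ N := one_le_numIdx d b
  have hκ : 1 ≤ κ := hK.one_le_supNorm
  have hR : 1 ≤ R := le_max_left _ _
  have hcl : 0 < cl := mul_pos hc0 (minEigen_pos b hK)
  have hm0 : 0 < m := by positivity
  have hq : 0 < √m := Real.sqrt_pos.2 hm0
  have hsq : √m * √m = m := Real.mul_self_sqrt hm0.le
  have ha : 1 ≤ a := le_max_left _ _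
  have hR0 : 0 ≤ supNorm (deriv ρ) := (abs_nonneg _).trans (hρ.abs_deriv_le 0)
  have hε0 : 0 < ε := lt_of_lt_of_le (by positivity) hε
  have hx : 2 * a ≤ cl / (2 * N) * ε := by
    calc 2 * a = cl / (2 * N) * (4 * N / cl * a) := by field_simp; ring
      _ ≤ _ := by gcongr
  set y := cl / (2 * N) * ε - a with hy
  set E := y ^ 2 / (8 * κ ^ 2 * R ^ 2 + 4 * κ / (3 * N) * R * (cl * ε / √m)) with hE
  have hbound : deviationBound N (sigmaConst d κ) c (minEigen b K) κ (supNorm (deriv ρ)) m β ε =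
      N * sigmaConst d κ * Real.exp (-E) := by
    have hmax : max 1 (supNorm (deriv ρ) ^ 2) = R ^ 2 := by
      rcases le_total (supNorm (deriv ρ)) 1 with h1 | h1
      · rw [hRdef, max_eq_left h1, max_eq_left (pow_le_one₀ hR0 h1), one_pow]
      · rw [hRdef, max_eq_right h1, max_eq_right (one_le_pow₀ h1)]
    rw [deviationBound, hmax]
  rw [hbound]
  have hSig := six_le_sigmaConst hd hκ
  have hrhs0 : 0 ≤ N * sigmaConst d κ * Real.exp (-E) :=
    mul_nonneg (mul_nonneg (by linarith) (by linarith)) (Real.exp_pos _).le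
  by_cases hεδ : ε ≤ √m * δ
  swap
  -- For `ε > √m δ` the event is empty, since one coordinate cannot differ by more than the
  -- Euclidean distance.
  · have hempty : {ω | ε ≤ √m * |θhat ω (zeroIdx d b) - f x₀| ∧ θhat ω ∈ paramBall M θ δ} = ∅ := by
      refine Set.eq_empty_of_forall_notMem fun ω hω => hεδ (hω.1.trans ?_)
      refine mul_le_mul_of_nonneg_left ?_ hq.le
      rw [← taylorCoeff_zeroIdx (b := b) f x₀ h]
      exact (abs_sub_le_sqrt_sum _ _ _).trans hω.2.2
    rw [hempty]
    simpa using hrhs0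
  set r := ε / √m with hr
  have hr0 : 0 < r := by positivity
  have hrδ : r ≤ δ := by rw [hr, div_le_iff₀ hq, mul_comm]; exact hεδ
  have hy0 : 0 ≤ y := by linarith
  have hβ : ∀ x ∈ nbhd x₀ h, |f x - localPoly x₀ h θ x| ≤ β := fun x hx =>
    le_csSup hbias ⟨x, hx, rfl⟩
  have hβ0 : 0 ≤ β := Real.sSup_nonneg (by rintro _ ⟨x, -, rfl⟩; exact abs_nonneg _)
  set AK := {ω | √m * √m ≤ |deviation P X ξ (fun y => K (rescale x₀ h y.1)) ω|}
  set AC : multiIdx d b → Set Ω := fun p =>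
    {ω | √m * (y / 2) ≤ |deviation P X ξ (scoreTerm ρ K x₀ h f θ p) ω|}
  set AN : multiIdx d b → (multiIdx d b → ℝ) → Set Ω := fun p v =>
    {ω | √m * (y / 4) ≤ |deviation P X ξ (fun y =>
        scoreTerm ρ K x₀ h f (θ + r • v) p y - scoreTerm ρ K x₀ h f θ p y) ω|}
  -- The covering sets no longer involve the estimator, so its measurability never enters.
  have hsub : {ω | ε ≤ √m * |θhat ω (zeroIdx d b) - f x₀| ∧ θhat ω ∈ paramBall M θ δ} ⊆
      AK ∪ ((⋃ p, AC p) ∪ ⋃ p, ⋃ v ∈ F, AN p v) := by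
    intro ω hω
    have hrt : r ≤ √(∑ p, (θhat ω p - θ p) ^ 2) := by
      refine le_trans ?_ (abs_sub_le_sqrt_sum _ _ (zeroIdx d b))
      rw [hr, div_le_iff₀ hq, mul_comm, hθdef, taylorCoeff_zeroIdx]
      exact hω.1
    obtain ⟨u, hu, p, hp⟩ := exists_le_abs_deviation hD hK hρ hw hh hn hf hg hL hα hc0 hHol hc
      hw₀ hβ0 hβ hθ (hθhat ω) hr0 hrt (le_trans (by gcongr) hδw)
    have hyp : √m * y ≤ m * (cl / (2 * N) * r - β) := by
      have : m * (cl / (2 * N) * r - β) = √m * (cl / (2 * N) * ε - β * √m) := by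
        rw [hr]
        field_simp
        rw [Real.sq_sqrt hm0.le]
      rw [this, hy]
      gcongr
      exact le_max_right _ _
    -- The mesh `cl/(48N)` is tuned to this: as `r √m = ε`, the left side is `x/8` with `x = cl
    -- ε/(2N)`, and `y ≥ x/2` by `hx`.
    have hη : 3 * (r * (cl / (48 * N))) * √m ≤ y / 4 := by
      have : 3 * (r * (cl / (48 * N))) * √m = cl / (2 * N) * ε / 8 := by
        rw [hr]
        field_simp
        ring
      rw [this]
      linarith
    rcases exists_deviation_net hD hK hρ hw hh hn hf hr0 (hF u hu) hη (hyp.trans hp) with h1 | h1 | h1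
    · exact Or.inl h1
    · exact Or.inr (Or.inl (Set.mem_iUnion.2 ⟨p, h1⟩))
    · obtain ⟨v, hv, h1⟩ := h1
      exact Or.inr (Or.inr (Set.mem_iUnion.2 ⟨p, Set.mem_iUnion₂.2 ⟨v, hv, h1⟩⟩))
  have hPK : P.real AK ≤ 2 * Real.exp (-E) := by
    refine (measureReal_deviation_ge_le hD hK hw hh hn
      (hK.measurable.comp ((measurable_rescale x₀ h).comp measurable_fst)) one_pos
      (fun y => by rw [one_mul]; exact (abs_of_nonneg (hK.nonneg _)).le) hq.le).trans ?_
    gcongr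
    exact exponent_le_kernel hN hκ hR hcl hq ha hx hε0 hεδ hδK
  have hPC : ∀ p, P.real (AC p) ≤ 2 * Real.exp (-E) := by
    intro p
    refine (measureReal_deviation_ge_le (A := R) hD hK hw hh hn (measurable_scoreTerm hK hf θ p)
      (by positivity) (fun y => (abs_scoreTerm_le hK hρ θ p y).trans
        (mul_le_mul_of_nonneg_right (le_max_right _ _) (hK.nonneg _))) (by positivity)).trans ?_
    gcongr
    exact exponent_le_center hN hκ hR hcl hq ha hx
  -- The extra factor absorbs the union over the net, because `|F| exp(-|F|) ≤ 1`.
  have hPN : ∀ p, ∀ v ∈ F, P.real (AN p v) ≤ 2 * (Real.exp (-E) * Real.exp (-F.card)) := by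
    intro p v hv
    refine (measureReal_deviation_ge_le (A := N * r) hD hK hw hh hn
      (measurable_sub_scoreTerm hK hf (θ + r • v) θ p) (by positivity)
      (fun y => (abs_scoreTerm_sub_le hK hρ hw hh (θ + r • v) θ p y).trans
        (mul_le_mul_of_nonneg_right ?_ (hK.nonneg _))) (by positivity)).trans ?_
    · have : ∑ q, |(θ + r • v) q - θ q| = r * ∑ q, |v q| := by
        simp [abs_mul, abs_of_pos hr0, Finset.mul_sum]
      rw [this, mul_comm N]
      exact mul_le_mul_of_nonneg_left (sum_abs_le_numIdx (hF1 v hv)) hr0.le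
    · rw [← Real.exp_add, ← neg_add]
      gcongr
      exact exponent_add_le_net hN hκ hR hcl hq ha hx hε0 hεδ (Nat.cast_nonneg _) hδF
  have hcard : (Fintype.card (multiIdx d b) : ℝ) = N := by simp [hNdef, numIdx]
  have hFexp : (F.card : ℝ) * Real.exp (-F.card) ≤ 1 := by
    rw [Real.exp_neg, ← div_eq_mul_inv, div_le_one (Real.exp_pos _)]
    linarith [Real.add_one_le_exp (F.card : ℝ)]
  have hPCs : P.real (⋃ p, AC p) ≤ N * (2 * Real.exp (-E)) := by
    refine (measureReal_iUnion_fintype_le _).trans ((Finset.sum_le_sum fun p _ => hPC p).trans ?_)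
    rw [Finset.sum_const, Finset.card_univ, nsmul_eq_mul, hcard]
  have hPNs : P.real (⋃ p, ⋃ v ∈ F, AN p v) ≤ N * (2 * Real.exp (-E)) := by
    refine (measureReal_iUnion_fintype_le _).trans ((Finset.sum_le_sum fun p _ =>
      (measureReal_biUnion_finset_le F _).trans (Finset.sum_le_sum fun v hv => hPN p v hv)).trans ?_)
    rw [Finset.sum_const, Finset.sum_const, Finset.card_univ, nsmul_eq_mul, nsmul_eq_mul, hcard]
    refine mul_le_mul_of_nonneg_left ?_ (by linarith)
    calc (F.card : ℝ) * (2 * (Real.exp (-E) * Real.exp (-F.card)))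
        = 2 * Real.exp (-E) * (F.card * Real.exp (-F.card)) := by ring
      _ ≤ 2 * Real.exp (-E) * 1 := by gcongr
      _ = _ := mul_one _
  calc _ ≤ P.real (AK ∪ ((⋃ p, AC p) ∪ ⋃ p, ⋃ v ∈ F, AN p v)) := measureReal_mono hsub
    _ ≤ P.real AK + (P.real (⋃ p, AC p) + P.real (⋃ p, ⋃ v ∈ F, AN p v)) :=
        (measureReal_union_le _ _).trans (by gcongr; exact measureReal_union_le _ _)
    _ ≤ 2 * Real.exp (-E) + (N * (2 * Real.exp (-E)) + N * (2 * Real.exp (-E))) := by gcongr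
    _ = (2 + 4 * N) * Real.exp (-E) := by ring
    _ ≤ N * sigmaConst d κ * Real.exp (-E) := by
        gcongr
        nlinarith

end

end LocalM

end

/-! ### Choice of the radius `δ` -/

theorem proposition1 {d : ℕ} (hd : 0 < d) (b : ℕ)
    (K : (Fin d → ℝ) → ℝ) (hK : LocalM.IsKernel K)
    (ρ : ℝ → ℝ) (hρ : LocalM.IsContrast ρ) (L α : ℝ) (hL : 0 < L) (hα : 0 < α)
    (c : ℝ) (hc : 0 < c) :
    ∃ δ : ℝ, 0 < δ ∧
      ∀ (n : ℕ), 0 < n →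
      ∀ g ∈ LocalM.densityClass ρ c n, LocalM.SecondDerivHolder ρ L α g →
      ∀ (h : ℝ), (n : ℝ) ^ (-(1 : ℝ) / d) < h →
      ∀ (M : ℝ), 0 < M →
      ∀ x₀ ∈ LocalM.unitCube d,
      -- the kernel window lies in the domain of the regression function
      (∀ z, K z ≠ 0 → x₀ + h • z ∈ LocalM.unitCube d) →
      ∀ (f : (Fin d → ℝ) → ℝ), Measurable f →
      LocalM.taylorCoeff f x₀ h ∈ LocalM.paramSet d b M →
      BddAbove (LocalM.biasValues b f x₀ h) →
      ∀ (Ω : Type*) [MeasurableSpace Ω] (P : Measure Ω) [IsProbabilityMeasure P]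
        (X : Fin n → Ω → Fin d → ℝ) (ξ : Fin n → Ω → ℝ), LocalM.IsDesignNoise P g X ξ →
      ∀ (θhat : Ω → LocalM.multiIdx d b → ℝ),
      (∀ ω, LocalM.IsLocalMEstimate ρ K M x₀ h
        (fun i => X i ω) (fun i => f (X i ω) + ξ i ω) (θhat ω)) →
      ∀ (ε : ℝ),
      4 * LocalM.numIdx d b / (c * LocalM.minEigen b K) *
          max 1 (LocalM.bias b f x₀ h * √(n * h ^ d)) ≤ ε →
      P.real {ω | ε ≤ √(n * h ^ d) * |θhat ω (LocalM.zeroIdx d b) - f x₀| ∧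
          θhat ω ∈ LocalM.paramBall M (LocalM.taylorCoeff f x₀ h) δ} ≤
        LocalM.deviationBound (LocalM.numIdx d b)
          (LocalM.sigmaConst d (LocalM.supNorm K)) c (LocalM.minEigen b K)
          (LocalM.supNorm K) (LocalM.supNorm (deriv ρ)) (n * h ^ d)
          (LocalM.bias b f x₀ h) ε := by
  obtain ⟨F, hF1, hF⟩ := LocalM.exists_finset_sphere_net (LocalM.multiIdx d b)
    (η := c * LocalM.minEigen b K / (48 * LocalM.numIdx d b)) (by
      have := LocalM.minEigen_pos b hK
      have := LocalM.one_le_numIdx d b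
      positivity)
  have hN := LocalM.one_le_numIdx d b
  have hκ := hK.one_le_supNorm
  have hlam := LocalM.minEigen_pos b hK
  set N : ℝ := (LocalM.numIdx d b : ℝ) with hNdef
  set κ := LocalM.supNorm K with hκdef
  set cl := c * LocalM.minEigen b K with hcldef
  have hcl : 0 < cl := mul_pos hc hlam
  -- The solution of `L w₀^α = c/2`, that is, the range on which the averaged score keeps half of
  -- its slope.
  set w₀ : ℝ := (c / (2 * L)) ^ (1 / α) with hw₀def
  have hw₀pos : 0 < w₀ := by positivity
  have hw₀ : L * w₀ ^ α ≤ c / 2 := by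
    rw [hw₀def, ← Real.rpow_mul (by positivity), one_div_mul_cancel hα.ne', Real.rpow_one]
    apply le_of_eq
    field_simp
  set D : ℝ := 32 * κ * (N ^ 2 + cl) * (1 + F.card) with hDdef
  have hD1 : 1 ≤ D := by
    have h1 : 1 ≤ N ^ 2 := one_le_pow₀ hN
    have h2 : 1 ≤ κ * (N ^ 2 + cl) := one_le_mul_of_one_le_of_one_le hκ (by linarith)
    have h3 : (1 : ℝ) ≤ 1 + F.card := by simp
    have h4 : 1 ≤ κ * (N ^ 2 + cl) * (1 + F.card) := one_le_mul_of_one_le_of_one_le h2 h3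
    rw [hDdef]
    linarith
  -- The three bounds serve, in order, the slope of the averaged score on the sphere, the kernel
  -- event and the net increments. The last needs `δ² D ≤ 1`, for which `δ ≤ 1/D` suffices as `D ≥
  -- 1`.
  have hδpos : 0 < min (w₀ / N) (min (2 * N / (cl * κ)) (1 / D)) := by positivity
  refine ⟨_, hδpos, ?_⟩
  intro n hn g hg hHol h hh M hM x₀ _ hwin f hf hθ hbias Ω _ P _ X ξ hDN θhat hθhat ε hε
  set δ := min (w₀ / N) (min (2 * N / (cl * κ)) (1 / D)) with hδdef
  have hh0 : 0 < h := lt_of_le_of_lt (by positivity) hh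
  have hcg : ∀ i, c ≤ ∫ z, deriv (deriv ρ) z * g i z := fun i =>
    hg.2.trans (ciInf_le (Set.finite_range _).bddBelow i)
  refine LocalM.measureReal_le_deviationBound hd hDN hK hρ hwin hh0 hn hf hg.1 hL hα hc hHol hcg
    hw₀ hθ hbias hF1 hF ?_ ?_ ?_ hθhat hε
  · rw [mul_comm, ← le_div_iff₀ (by positivity)]
    exact min_le_left _ _
  · exact (min_le_right _ _).trans (min_le_left _ _)
  · have h1 : δ ≤ 1 / D := (min_le_right _ _).trans (min_le_right _ _)
    have h2 : δ * D ≤ 1 := (le_div_iff₀ (by positivity)).1 h1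
    have h3 : δ ≤ 1 := h1.trans ((div_le_one (by positivity)).2 hD1)
    calc 32 * κ * δ ^ 2 * (N ^ 2 + cl) * (1 + F.card) = δ * (δ * D) := by rw [hDdef]; ring
      _ ≤ 1 := mul_le_one₀ h3 (by positivity) h2
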